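/- Let $d\ge 1$. Let $\Omega$ be a finite probability space in which every point has positive probability, with expectation $\langle\cdot\rangle$, and let $\tau_x:\Omega\to\Omega$, $x\in\mathbf Z^d$, be measure preserving maps with $\tau_x\tau_y=\tau_{x+y}$, $\tau_0=\mathrm{id}$, whose action on $\Omega$ is ergodic. Put $R(x_1,x_2,\dots,x_d)=(-x_1,x_2,\dots,x_d)$ and let $\mathbf e_1,\dots,\mathbf e_d$ be the standard basis of $\mathbf Z^d$. Let $b:\Omega\to\mathbf R$ satisfy $\sup_{\omega}|b(\omega)|<\frac1{2d}$ and be reflection invariant, i.e. $$\Big\langle \prod_{i=1}^n b(\tau_{x_i}\cdot)\Big\rangle=(-1)^n\Big\langle \prod_{i=1}^n b(\tau_{Rx_i}\cdot)\Big\rangle\qquad\text{for all } n\ge1,\ x_1,\dots,x_n\in\mathbf Z^d .$$ Then there is a number $q(b)$ with $0<q(b)<\infty$ such that for every smooth compactly supported $f:\mathbf R^d\to\mathbf R$ the following holds. For every $\varepsilon>0$ the equation $$u_\varepsilon(x,\omega)-\sum_{i=1}^d\frac1{2d}\big[u_\varepsilon(x+\varepsilon\mathbf e_i,\omega)+u_\varepsilon(x-\varepsilon\mathbf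 e_i,\omega)\big]-b(\tau_{x/\varepsilon}\,\omega)\big[u_\varepsilon(x+\varepsilon\mathbf e_1,\omega)-u_\varepsilon(x-\varepsilon\mathbf e_1,\omega)\big]+\varepsilon^2u_\varepsilon(x,\omega)=\varepsilon^2f(x),$$ $x\in\varepsilon\mathbf Z^d$, $\omega\in\Omega$, has a unique bounded solution $u_\varepsilon:\varepsilon\mathbf Z^d\times\Omega\to\mathbf R$; the equation $$-q(b)\frac{\partial^2u}{\partial x_1^2}-\sum_{j=2}^d\frac1{2d}\frac{\partial^2u}{\partial x_j^2}+u(x)=f(x),\qquad x\in\mathbf R^d,$$ has a unique bounded $C^2$ solution $u$; and $$\lim_{\varepsilon\to0^+}\ \sup_{x\in\mathbf R^d,\ \omega\in\Omega}\big|u_\varepsilon(\varepsilon\lfloor x/\varepsilon\rfloor,\omega)-u(x)\big|=0,$$ where $\lfloor\cdot\rfloor$ is the integer part, taken coordinatewise. -/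

import Mathlib

open MeasureTheory Filter Topology

namespace DriftHomogenization

/-- The point `ε n` of the scaled lattice `ε ℤ^d`, as a point of `ℝ^d`. -/
noncomputable def latticePoint {d : ℕ} (ε : ℝ) (n : Fin d → ℤ) : EuclideanSpace ℝ (Fin d) :=
  WithLp.toLp 2 fun i => ε * (n i : ℝ)

/-- The coordinatewise integer part of `x / ε`. -/
noncomputable def latticeFloor {d : ℕ} (ε : ℝ) (x : EuclideanSpace ℝ (Fin d)) : Fin d → ℤ :=
  fun i => ⌊x i / ε⌋

/-- The standard basis vector of `ℤ^d` in direction `i`. -/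
def latticeVec {d : ℕ} (i : Fin d) : Fin d → ℤ := Pi.single i 1

/-- The reflection `R (x₁, x₂, …, x_d) = (-x₁, x₂, …, x_d)` of `ℤ^d`
(the first coordinate has index `0`). -/
def reflect {d : ℕ} [NeZero d] (x : Fin d → ℤ) : Fin d → ℤ :=
  Function.update x 0 (-x 0)

/-- Reflection invariance of `b` with respect to the expectation on `Ω`:
`⟨∏ b(τ_{x_i} ·)⟩ = (-1)^n ⟨∏ b(τ_{R x_i} ·)⟩` for all `n ≥ 1` and `x₁, …, x_n ∈ ℤ^d`.
The translation operator is `τ_x ω = x +ᵥ ω`. -/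
def ReflectionInvariant {d : ℕ} [NeZero d] {Ω : Type*} [MeasurableSpace Ω]
    [AddAction (Fin d → ℤ) Ω] (μ : Measure Ω) (b : Ω → ℝ) : Prop :=
  ∀ n : ℕ, 1 ≤ n → ∀ x : Fin n → (Fin d → ℤ),
    ∫ ω, ∏ i, b (x i +ᵥ ω) ∂μ = (-1) ^ n * ∫ ω, ∏ i, b (reflect (x i) +ᵥ ω) ∂μ

/-- `v` is a bounded solution of the discrete equation with parameter `ε`. A function `u_ε` on
`ε ℤ^d × Ω` is represented by `v n ω = u_ε(ε n, ω)`, `n ∈ ℤ^d`, so that `x = ε n`,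
`x ± ε e_i = ε (n ± e_i)` and `τ_{x/ε} = τ_n`. -/
structure IsDiscreteSolution {d : ℕ} [NeZero d] {Ω : Type*} [AddAction (Fin d → ℤ) Ω]
    (b : Ω → ℝ) (f : EuclideanSpace ℝ (Fin d) → ℝ) (ε : ℝ)
    (v : (Fin d → ℤ) → Ω → ℝ) : Prop where
  bounded : ∃ C : ℝ, ∀ n ω, |v n ω| ≤ C
  equation : ∀ n ω,
    v n ω
      - ∑ i : Fin d, 1 / (2 * (d : ℝ)) * (v (n + latticeVec i) ω + v (n - latticeVec i) ω)
      - b (n +ᵥ ω) * (v (n + latticeVec 0) ω - v (n - latticeVec 0) ω)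
      + ε ^ 2 * v n ω
    = ε ^ 2 * f (latticePoint ε n)

/-- The partial derivative `∂u/∂x_j`. -/
noncomputable def partialDeriv {d : ℕ} (j : Fin d) (u : EuclideanSpace ℝ (Fin d) → ℝ) :
    EuclideanSpace ℝ (Fin d) → ℝ :=
  fun x => fderiv ℝ u x (EuclideanSpace.single j 1)

/-- `u` is a bounded classical solution on `ℝ^d` of
`- q ∂²u/∂x₁² - ∑_{j ≥ 2} (1/2d) ∂²u/∂x_j² + u = f`. -/
structure IsHomogenizedSolution {d : ℕ} [NeZero d] (q : ℝ)
    (f : EuclideanSpace ℝ (Fin d) → ℝ) (u : EuclideanSpace ℝ (Fin d) → ℝ) : Prop where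
  contDiff : ContDiff ℝ 2 u
  bounded : ∃ C : ℝ, ∀ x, |u x| ≤ C
  equation : ∀ x,
    -(q * partialDeriv 0 (partialDeriv 0 u) x)
      - ∑ j ∈ Finset.univ.erase (0 : Fin d),
          1 / (2 * (d : ℝ)) * partialDeriv j (partialDeriv j u) x
      + u x
    = f x

end DriftHomogenization

/-! The equation is the resolvent equation, with killing of order `ε ^ 2`, of a nearest-neighbour
walk whose drift is read off the environment. Since only the drift field matters, Ω is replaced by
the finite set Y of drift profiles, on which the environment seen from the walk is a finite Markov
chain with generator L (`envGenerator`).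

Ergodicity and positive masses make the action transitive, and `|b| < 1/(2d)` makes all jump
probabilities positive. The maximum principle then shows that ker L consists of constants and that
the range of L contains no nonzero constant, so `L ψ = h - c` is solvable for a unique number c, the
mean of h under the invariant law (`exists_envGenerator_eq`).

Reflection invariance concerns the law of b only, but equality of moments on a finite space turns it
into a map S of Y with `b ∘ S = -b` (`exists_profile_reflection`). Functions odd under S have mean
zero. Hence the corrector `L χ = -2b` exists, and the fluxes of χ in directions other than the first
average to zero. The first flux defines q, which is also the mean of a squared gradient of x₁ + χ; q
≤ 0 would force χ to drop by 1 at each step along e₁, impossible on a finite set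
(`exists_correctors`).

The homogenized solution w is a Schwartz function, so the expansion w + ε χ ∂₁w + ε² ∑ ψ_j ∂_j∂₁w
satisfies the discrete equation up to O(ε³). The discrete maximum principle costs a factor ε⁻², and
the error is O(ε) uniformly (`exists_homogenization_rate`). -/

namespace DriftHomogenization

/-! ### Existence for the constant-coefficient equation by Fourier multipliers. -/

section ConstantCoefficients

open scoped SchwartzMap LineDeriv ContDiff
open SchwartzMap

variable {d : ℕ}

/-- The diagonal map scaling the `j`-th coordinate by `c j`. -/
noncomputable def diagonalScaling (c : Fin d → ℝ) :
    EuclideanSpace ℝ (Fin d) →L[ℝ] EuclideanSpace ℝ (Fin d) :=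
  LinearMap.toContinuousLinearMap
    { toFun := fun x => WithLp.toLp 2 fun j => c j * x j
      map_add' := fun x y => by ext j; simp [mul_add]
      map_smul' := fun r x => by ext j; simp; ring }

lemma norm_sq_diagonalScaling (c : Fin d → ℝ) (x : EuclideanSpace ℝ (Fin d)) :
    ‖diagonalScaling c x‖ ^ 2 = ∑ j, c j ^ 2 * x j ^ 2 := by
  simp [diagonalScaling, EuclideanSpace.norm_sq_eq, mul_pow]

/-- The Fourier symbol of `1 - ∑ a j ∂_j²`. -/
noncomputable def ellipticSymbol (a : Fin d → ℝ) (x : EuclideanSpace ℝ (Fin d)) : ℝ :=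
  1 + ∑ j, (2 * Real.pi) ^ 2 * a j * x j ^ 2

lemma ellipticSymbol_pos {a : Fin d → ℝ} (ha : ∀ j, 0 ≤ a j) (x : EuclideanSpace ℝ (Fin d)) :
    0 < ellipticSymbol a x := by
  have : 0 ≤ ∑ j, (2 * Real.pi) ^ 2 * a j * x j ^ 2 :=
    Finset.sum_nonneg fun j _ => by have := ha j; positivity
  unfold ellipticSymbol
  linarith

lemma hasTemperateGrowth_coord (j : Fin d) :
    (fun x : EuclideanSpace ℝ (Fin d) => x j).HasTemperateGrowth :=
  (EuclideanSpace.proj j : EuclideanSpace ℝ (Fin d) →L[ℝ] ℝ).hasTemperateGrowth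

lemma inner_single_one (x : EuclideanSpace ℝ (Fin d)) (j : Fin d) :
    inner ℝ x (EuclideanSpace.single j (1 : ℝ)) = x j := by
  rw [EuclideanSpace.inner_single_right]
  simp

lemma hasTemperateGrowth_coord_sq (j : Fin d) :
    (fun x : EuclideanSpace ℝ (Fin d) => x j ^ 2).HasTemperateGrowth :=
  (hasTemperateGrowth_coord j).pow 2

lemma hasTemperateGrowth_ellipticSymbol (a : Fin d → ℝ) :
    (ellipticSymbol a).HasTemperateGrowth := by
  refine (Function.HasTemperateGrowth.const (1 : ℝ)).add ?_
  have := Function.HasTemperateGrowth.sum (s := Finset.univ)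
    (f := fun j (x : EuclideanSpace ℝ (Fin d)) => (2 * Real.pi) ^ 2 * a j * x j ^ 2)
    fun j _ => (Function.HasTemperateGrowth.const _).mul (hasTemperateGrowth_coord_sq j)
  convert this using 1

/-- The symbol is 1 + |Ax|² with A diagonal, so its inverse is a linear pullback of (1 + |x|²)⁻¹.
This remains valid when some `a j` vanish. -/
lemma hasTemperateGrowth_inv_ellipticSymbol {a : Fin d → ℝ} (ha : ∀ j, 0 ≤ a j) :
    (fun x => (ellipticSymbol a x)⁻¹).HasTemperateGrowth := by
  have h := (Function.hasTemperateGrowth_one_add_norm_sq_rpow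
    (EuclideanSpace ℝ (Fin d)) (-1)).comp
    (diagonalScaling fun j => 2 * Real.pi * √(a j)).hasTemperateGrowth
  refine (congrArg Function.HasTemperateGrowth (funext fun x => ?_)).mpr h
  simp only [Function.comp_apply, norm_sq_diagonalScaling, Real.rpow_neg_one, ellipticSymbol,
    mul_pow, Real.sq_sqrt (ha _)]

lemma lineDeriv_lineDeriv_eq_fourierMultiplier (j : Fin d)
    (U : 𝓢(EuclideanSpace ℝ (Fin d), ℂ)) :
    ∂_{EuclideanSpace.single j (1 : ℝ)} (∂_{EuclideanSpace.single j (1 : ℝ)} U) =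
      -((2 * Real.pi) ^ 2 : ℝ) • fourierMultiplierCLM ℂ
        (fun x : EuclideanSpace ℝ (Fin d) => x j ^ 2) U := by
  have hg := hasTemperateGrowth_coord j
  simp_rw [lineDeriv_eq_fourierMultiplierCLM, inner_single_one]
  rw [← fourierMultiplierCLM_ofReal ℂ hg, map_smul, smul_smul, fourierMultiplierCLM_ofReal ℂ hg,
    fourierMultiplierCLM_fourierMultiplierCLM_apply hg hg]
  have h1 : (2 * (Real.pi : ℂ) * Complex.I) * (2 * Real.pi * Complex.I)
      = ((-((2 * Real.pi) ^ 2 : ℝ) : ℝ) : ℂ) := by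
    push_cast; ring_nf; simp
  rw [h1]
  ext x
  simp [sq, Pi.mul_def]

theorem exists_complex_schwartz_solution {a : Fin d → ℝ} (ha : ∀ j, 0 ≤ a j)
    (F : 𝓢(EuclideanSpace ℝ (Fin d), ℂ)) :
    ∃ U : 𝓢(EuclideanSpace ℝ (Fin d), ℂ),
      U - ∑ j, a j • ∂_{EuclideanSpace.single j (1 : ℝ)} (∂_{EuclideanSpace.single j (1 : ℝ)} U)
        = F := by
  refine ⟨fourierMultiplierCLM ℂ (fun x => (ellipticSymbol a x)⁻¹) F, ?_⟩
  set U := fourierMultiplierCLM ℂ (fun x => (ellipticSymbol a x)⁻¹) F with hU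
  have hterm : ∀ j, ((fun x : EuclideanSpace ℝ (Fin d) =>
      (2 * Real.pi) ^ 2 * a j * x j ^ 2)).HasTemperateGrowth := fun j =>
    (Function.HasTemperateGrowth.const _).mul (hasTemperateGrowth_coord_sq j)
  have hone : fourierMultiplierCLM ℂ (fun _ : EuclideanSpace ℝ (Fin d) => (1 : ℝ)) U = U := by
    simp
  have hsymb : fourierMultiplierCLM ℂ (ellipticSymbol a) U = F := by
    rw [hU, fourierMultiplierCLM_fourierMultiplierCLM_apply (hasTemperateGrowth_ellipticSymbol a)
      (hasTemperateGrowth_inv_ellipticSymbol ha)]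
    have : (ellipticSymbol a * fun x => (ellipticSymbol a x)⁻¹) = fun _ => (1 : ℝ) := by
      ext x
      exact mul_inv_cancel₀ (ellipticSymbol_pos ha x).ne'
    rw [this]
    simp
  have hsum : fourierMultiplierCLM ℂ (ellipticSymbol a) U =
      U + ∑ j, fourierMultiplierCLM ℂ
        (fun x : EuclideanSpace ℝ (Fin d) => (2 * Real.pi) ^ 2 * a j * x j ^ 2) U := by
    -- The index `none` carries the constant 1, so one sum over `Option (Fin d)` covers the whole
    -- symbol.
    have h3 := fourierMultiplierCLM_sum (E := EuclideanSpace ℝ (Fin d)) ℂ (s := Finset.univ)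
      (g := fun o : Option (Fin d) => o.elim (fun _ => (1 : ℝ))
          fun j (x : EuclideanSpace ℝ (Fin d)) => (2 * Real.pi) ^ 2 * a j * x j ^ 2) (by
        rintro (_ | j) _
        · exact Function.HasTemperateGrowth.const _
        · exact hterm j)
    have h4 := congrArg (fun T => T U) h3
    simp only [Fintype.sum_option, Option.elim, add_apply, _root_.sum_apply, hone] at h4
    rw [← h4]
    rfl
  rw [← hsymb, hsum, sub_eq_add_neg, ← Finset.sum_neg_distrib]
  congr 1
  refine Finset.sum_congr rfl fun j _ => ?_
  rw [lineDeriv_lineDeriv_eq_fourierMultiplier]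
  have h5 := fourierMultiplierCLM_smul (F := ℂ) (hasTemperateGrowth_coord_sq j)
    ((2 * Real.pi) ^ 2 * a j)
  have h6 := congrArg (fun T => T U) h5
  have h7 : ((2 * Real.pi) ^ 2 * a j) • (fun x : EuclideanSpace ℝ (Fin d) => x j ^ 2)
      = fun x => (2 * Real.pi) ^ 2 * a j * x j ^ 2 := by
    ext x; simp
  rw [h7] at h6
  rw [h6]
  ext x
  simp
  ring

/-- The multipliers act on complex functions; as the coefficients are real, the real part of the
complex solution solves the real equation. -/
theorem exists_schwartz_solution {a : Fin d → ℝ} (ha : ∀ j, 0 ≤ a j)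
    {f : EuclideanSpace ℝ (Fin d) → ℝ} (hf : ContDiff ℝ ∞ f) (hc : HasCompactSupport f) :
    ∃ w : 𝓢(EuclideanSpace ℝ (Fin d), ℝ), ∀ x,
      w x - ∑ j, a j * (∂_{EuclideanSpace.single j (1 : ℝ)}
        (∂_{EuclideanSpace.single j (1 : ℝ)} w)) x = f x := by
  obtain ⟨U, hU⟩ := exists_complex_schwartz_solution ha
    ((hc.toSchwartzMap hf).postcompCLM Complex.ofRealCLM)
  refine ⟨U.postcompCLM Complex.reCLM, fun x => ?_⟩
  have hD : ∀ (V : 𝓢(EuclideanSpace ℝ (Fin d), ℂ)) (m : EuclideanSpace ℝ (Fin d)),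
      ∂_{m} (V.postcompCLM Complex.reCLM) = (∂_{m} V).postcompCLM Complex.reCLM := by
    intro V m
    ext y
    have := (Complex.reCLM.hasFDerivAt (x := V y)).comp y (V.hasFDerivAt y)
    rw [lineDerivOp_apply_eq_fderiv, postcompCLM_apply, lineDerivOp_apply_eq_fderiv]
    have h2 : ⇑(V.postcompCLM Complex.reCLM) = Complex.reCLM ∘ V := rfl
    rw [h2, this.fderiv]
    rfl
  have h := congrArg (fun W : 𝓢(EuclideanSpace ℝ (Fin d), ℂ) => (W x).re) hU
  simp only [sub_apply, Complex.sub_re, postcompCLM_apply, sum_apply,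
    Complex.re_sum, smul_apply] at h
  simp only [hD, postcompCLM_apply]
  simpa using h

end ConstantCoefficients

/-! ### Maximum principle and uniqueness for the homogenized equation. -/

section Uniqueness

variable {d : ℕ}

/-- A positive second derivative would make the point a local minimum too, hence the function
locally constant, with zero second derivative. -/
lemma second_deriv_nonpos_of_isLocalMax {φ : ℝ → ℝ} {t : ℝ} (h : IsLocalMax φ t)
    (hc : ContinuousAt φ t) : deriv (deriv φ) t ≤ 0 := by
  by_contra! hpos
  have hmin := isLocalMin_of_deriv_deriv_pos hpos h.deriv_eq_zero hc
  have hconst : φ =ᶠ[𝓝 t] fun _ => φ t := by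
    filter_upwards [h, hmin] with s h1 h2 using le_antisymm h1 h2
  have h1 : deriv φ =ᶠ[𝓝 t] fun _ => 0 := by
    filter_upwards [hconst.eventuallyEq_nhds] with s hs
    rw [hs.deriv_eq, deriv_const]
  rw [h1.deriv_eq, deriv_const] at hpos
  exact lt_irrefl _ hpos

lemma hasDerivAt_along_line {g : EuclideanSpace ℝ (Fin d) → ℝ} (hg : Differentiable ℝ g)
    (j : Fin d) (x : EuclideanSpace ℝ (Fin d)) (t : ℝ) :
    HasDerivAt (fun s : ℝ => g (x + s • EuclideanSpace.single j 1))
      (partialDeriv j g (x + t • EuclideanSpace.single j 1)) t := by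
  have h1 : HasDerivAt (fun s : ℝ => x + s • EuclideanSpace.single j (1 : ℝ))
      (EuclideanSpace.single j (1 : ℝ)) t := by
    simpa using ((hasDerivAt_id t).smul_const (EuclideanSpace.single j (1 : ℝ))).const_add x
  exact (hg _).hasFDerivAt.comp_hasDerivAt t h1

lemma contDiff_partialDeriv {u : EuclideanSpace ℝ (Fin d) → ℝ} (hu : ContDiff ℝ 2 u)
    (j : Fin d) : ContDiff ℝ 1 (partialDeriv j u) :=
  (hu.fderiv_right (m := 1) (by norm_num)).clm_apply contDiff_const

lemma norm_sq_add_smul_single (x : EuclideanSpace ℝ (Fin d)) (j : Fin d) (t : ℝ) :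
    ‖x + t • EuclideanSpace.single j (1 : ℝ)‖ ^ 2 = ‖x‖ ^ 2 + 2 * t * x j + t ^ 2 := by
  rw [norm_add_sq_real, inner_smul_right, norm_smul, inner_single_one]
  simp
  ring

/-- A bounded u need not attain its supremum, but u - δ|y|² does. There each pure second derivative
of u is at most 2δ, so the equation bounds u by a multiple of δ; then δ → 0. -/
theorem nonpos_of_elliptic_eq {a : Fin d → ℝ} (ha : ∀ j, 0 ≤ a j)
    {u : EuclideanSpace ℝ (Fin d) → ℝ} (hu : ContDiff ℝ 2 u) {C : ℝ} (hC : ∀ x, u x ≤ C)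
    (heq : ∀ x, u x = ∑ j, a j * partialDeriv j (partialDeriv j u) x)
    (x : EuclideanSpace ℝ (Fin d)) : u x ≤ 0 := by
  have key : ∀ δ > 0, u x ≤ δ * (2 * ∑ j, a j + ‖x‖ ^ 2) := by
    intro δ hδ
    have hcont : Continuous fun y => u y - δ * ‖y‖ ^ 2 :=
      hu.continuous.sub (by fun_prop)
    have hlim : Tendsto (fun y : EuclideanSpace ℝ (Fin d) => u y - δ * ‖y‖ ^ 2)
        (cocompact _) atBot := by
      have h1 : Tendsto (fun y : EuclideanSpace ℝ (Fin d) => δ * ‖y‖ ^ 2)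
          (cocompact _) atTop :=
        ((tendsto_pow_atTop two_ne_zero).comp (tendsto_norm_cocompact_atTop)).const_mul_atTop hδ
      refine tendsto_atBot_mono (fun y => sub_le_sub_right (hC y) _) ?_
      exact tendsto_atBot_add_const_left _ C (tendsto_neg_atTop_atBot.comp h1)
    obtain ⟨y, hy⟩ := hcont.exists_forall_ge hlim
    have hsecond : ∀ j, partialDeriv j (partialDeriv j u) y ≤ 2 * δ := by
      intro j
      let φ : ℝ → ℝ := fun t => u (y + t • EuclideanSpace.single j 1)
        - δ * (‖y‖ ^ 2 + 2 * t * y j + t ^ 2)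
      have hmax : IsLocalMax φ 0 := by
        refine Eventually.of_forall fun t => ?_
        have := hy (y + t • EuclideanSpace.single j 1)
        rw [norm_sq_add_smul_single] at this
        simpa [φ] using this
      have hd1 : ∀ t, HasDerivAt φ (partialDeriv j u (y + t • EuclideanSpace.single j 1)
          - δ * (2 * y j + 2 * t)) t := by
        intro t
        have h1 := hasDerivAt_along_line (hu.differentiable (by norm_num)) j y t
        have h2 : HasDerivAt (fun t : ℝ => ‖y‖ ^ 2 + 2 * t * y j + t ^ 2) (2 * y j + 2 * t) t := by
          have h3 := (((hasDerivAt_id t).const_mul 2).mul_const (y j)).const_add (‖y‖ ^ 2)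
          have h4 := h3.add (hasDerivAt_pow 2 t)
          exact h4.congr_deriv (by simp)
        exact h1.sub (h2.const_mul δ)
      have hd2 : HasDerivAt (deriv φ) (partialDeriv j (partialDeriv j u) y - δ * 2) 0 := by
        have hfun : deriv φ = fun t => partialDeriv j u (y + t • EuclideanSpace.single j 1)
          - δ * (2 * y j + 2 * t) := funext fun t => (hd1 t).deriv
        rw [hfun]
        have h1 := hasDerivAt_along_line
          ((contDiff_partialDeriv hu j).differentiable (by norm_num)) j y 0
        have h2 : HasDerivAt (fun t : ℝ => 2 * y j + 2 * t) 2 0 := by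
          simpa using ((hasDerivAt_id (0 : ℝ)).const_mul 2).const_add (2 * y j)
        simp only [zero_smul, add_zero] at h1
        exact h1.sub (h2.const_mul δ)
      have := second_deriv_nonpos_of_isLocalMax hmax (hd1 0).continuousAt
      rw [hd2.deriv] at this
      linarith
    have h1 : u y ≤ 2 * δ * ∑ j, a j := by
      rw [heq y, Finset.mul_sum]
      refine Finset.sum_le_sum fun j _ => ?_
      have := mul_le_mul_of_nonneg_left (hsecond j) (ha j)
      linarith
    have h2 := hy x
    have h3 : 0 ≤ δ * ‖y‖ ^ 2 := by positivity
    nlinarith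
  have hlim : Tendsto (fun δ : ℝ => δ * (2 * ∑ j, a j + ‖x‖ ^ 2)) (𝓝[>] 0) (𝓝 0) := by
    have : Continuous fun δ : ℝ => δ * (2 * ∑ j, a j + ‖x‖ ^ 2) := by fun_prop
    simpa using (this.tendsto 0).mono_left nhdsWithin_le_nhds
  exact ge_of_tendsto hlim (eventually_nhdsWithin_of_forall fun δ hδ => key δ hδ)

lemma partialDeriv_sub {u v : EuclideanSpace ℝ (Fin d) → ℝ} (hu : Differentiable ℝ u)
    (hv : Differentiable ℝ v) (j : Fin d) :
    partialDeriv j (u - v) = partialDeriv j u - partialDeriv j v := by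
  ext x
  simp [partialDeriv, fderiv_sub (hu x) (hv x)]

/-- The coefficients of the homogenized operator. -/
noncomputable def homogenizedCoeff [NeZero d] (q : ℝ) (j : Fin d) : ℝ :=
  if j = 0 then q else 1 / (2 * (d : ℝ))

lemma sum_homogenizedCoeff [NeZero d] (q : ℝ) (g : Fin d → ℝ) :
    ∑ j, homogenizedCoeff q j * g j
      = q * g 0 + ∑ j ∈ Finset.univ.erase (0 : Fin d), 1 / (2 * (d : ℝ)) * g j := by
  rw [← Finset.add_sum_erase _ (fun j => homogenizedCoeff q j * g j) (Finset.mem_univ (0 : Fin d))]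
  have h0 : homogenizedCoeff q (0 : Fin d) = q := by simp [homogenizedCoeff]
  rw [h0]
  refine congrArg _ (Finset.sum_congr rfl fun j hj => ?_)
  rw [homogenizedCoeff, if_neg (Finset.ne_of_mem_erase hj)]

lemma homogenizedCoeff_nonneg [NeZero d] {q : ℝ} (hq : 0 ≤ q) (j : Fin d) :
    0 ≤ homogenizedCoeff q j := by
  unfold homogenizedCoeff
  split_ifs
  · exact hq
  · positivity

theorem IsHomogenizedSolution.le [NeZero d] {q : ℝ} (hq : 0 ≤ q)
    {f u v : EuclideanSpace ℝ (Fin d) → ℝ} (hu : IsHomogenizedSolution q f u)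
    (hv : IsHomogenizedSolution q f v) (x : EuclideanSpace ℝ (Fin d)) : u x ≤ v x := by
  obtain ⟨C, hC⟩ := hu.bounded
  obtain ⟨C', hC'⟩ := hv.bounded
  have h := nonpos_of_elliptic_eq (homogenizedCoeff_nonneg hq) (u := u - v)
    (hu.contDiff.sub hv.contDiff) (C := C + C')
    (fun y => by
      have := (abs_le.1 (hC y)).2
      have := (abs_le.1 (hC' y)).1
      simp only [Pi.sub_apply]
      linarith)
    (fun y => by
      have e1 := hu.equation y
      have e2 := hv.equation y
      have hD : ∀ j, partialDeriv j (partialDeriv j (u - v)) y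
          = partialDeriv j (partialDeriv j u) y - partialDeriv j (partialDeriv j v) y := by
        intro j
        rw [partialDeriv_sub (hu.contDiff.differentiable (by norm_num))
          (hv.contDiff.differentiable (by norm_num)),
          partialDeriv_sub ((contDiff_partialDeriv hu.contDiff j).differentiable (by norm_num))
          ((contDiff_partialDeriv hv.contDiff j).differentiable (by norm_num))]
        rfl
      rw [sum_homogenizedCoeff]
      simp only [hD, mul_sub, Finset.sum_sub_distrib, Pi.sub_apply]
      linarith) x
  simpa using h

open scoped SchwartzMap LineDeriv

lemma coe_lineDeriv_single (w : 𝓢(EuclideanSpace ℝ (Fin d), ℝ)) (j : Fin d) :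
    ⇑(∂_{EuclideanSpace.single j (1 : ℝ)} w : 𝓢(EuclideanSpace ℝ (Fin d), ℝ)) = partialDeriv j ⇑w := rfl

lemma schwartz_exists_bound (w : 𝓢(EuclideanSpace ℝ (Fin d), ℝ)) :
    ∃ C, 0 ≤ C ∧ ∀ x, |w x| ≤ C := by
  obtain ⟨C, hC, h⟩ := w.decay 0 0
  exact ⟨C, hC.le, fun x => by simpa using h x⟩

theorem exists_schwartz_isHomogenizedSolution [NeZero d] {q : ℝ} (hq : 0 ≤ q)
    {f : EuclideanSpace ℝ (Fin d) → ℝ} (hf : ContDiff ℝ ((⊤ : ℕ∞) : WithTop ℕ∞) f)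
    (hc : HasCompactSupport f) :
    ∃ w : 𝓢(EuclideanSpace ℝ (Fin d), ℝ), IsHomogenizedSolution q f w := by
  obtain ⟨w, hw⟩ := exists_schwartz_solution (homogenizedCoeff_nonneg hq) hf hc
  refine ⟨w, w.smooth 2, ?_, fun x => ?_⟩
  · obtain ⟨C, -, h⟩ := schwartz_exists_bound w
    exact ⟨C, h⟩
  · have := hw x
    rw [sum_homogenizedCoeff] at this
    simp only [coe_lineDeriv_single] at this
    rw [← this]
    ring

end Uniqueness

/-! ### The one-step averaging operator of the walk. -/

section WalkMean

variable {d : ℕ} [NeZero d]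

/-- The one-step average of the walk with drift `β`, given the values `p i` and `m i` at the
neighbours in directions `e_i` and `-e_i`. -/
noncomputable def walkMean (β : ℝ) (p m : Fin d → ℝ) : ℝ :=
  ∑ i, 1 / (2 * (d : ℝ)) * (p i + m i) + β * (p 0 - m 0)

lemma natCast_dim_pos : (0 : ℝ) < d := by exact_mod_cast Nat.pos_of_ne_zero (NeZero.ne d)

lemma walkMean_add (β : ℝ) (p m p' m' : Fin d → ℝ) :
    walkMean β (fun i => p i + p' i) (fun i => m i + m' i)
      = walkMean β p m + walkMean β p' m' := by
  have : ∀ i, 1 / (2 * (d : ℝ)) * (p i + p' i + (m i + m' i))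
      = 1 / (2 * (d : ℝ)) * (p i + m i) + 1 / (2 * (d : ℝ)) * (p' i + m' i) := fun i => by ring
  simp only [walkMean, this, Finset.sum_add_distrib]
  ring

lemma walkMean_mul (β c : ℝ) (p m : Fin d → ℝ) :
    walkMean β (fun i => c * p i) (fun i => c * m i) = c * walkMean β p m := by
  have : ∀ i, 1 / (2 * (d : ℝ)) * (c * p i + c * m i)
      = c * (1 / (2 * (d : ℝ)) * (p i + m i)) := fun i => by ring
  simp only [walkMean, this, ← Finset.mul_sum]
  ring

lemma walkMean_sum {ι : Type*} (s : Finset ι) (β : ℝ) (p m : ι → Fin d → ℝ) :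
    walkMean β (fun i => ∑ k ∈ s, p k i) (fun i => ∑ k ∈ s, m k i)
      = ∑ k ∈ s, walkMean β (p k) (m k) := by
  classical
  induction s using Finset.induction_on with
  | empty => simp [walkMean]
  | insert a s ha ih => simp only [Finset.sum_insert ha, walkMean_add, ih]

lemma walkMean_const (β c : ℝ) : walkMean β (fun _ : Fin d => c) (fun _ => c) = c := by
  have := natCast_dim_pos (d := d)
  simp only [walkMean, Finset.sum_const, Finset.card_univ, Fintype.card_fin, nsmul_eq_mul]
  field_simp
  ring

lemma walkMean_even (β : ℝ) (p : Fin d → ℝ) :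
    walkMean β p p = ∑ i, 1 / (2 * (d : ℝ)) * (2 * p i) := by
  simp [walkMean, two_mul]

lemma walkMean_odd (β : ℝ) (p : Fin d → ℝ) :
    walkMean β p (fun i => -p i) = 2 * β * p 0 := by
  simp only [walkMean, add_neg_cancel, mul_zero, Finset.sum_const_zero]
  ring

lemma walkMean_eq_sum (β : ℝ) (p m : Fin d → ℝ) :
    walkMean β p m = ∑ i, ((1 / (2 * (d : ℝ)) + if i = 0 then β else 0) * p i
      + (1 / (2 * (d : ℝ)) - if i = 0 then β else 0) * m i) := by
  have : ∀ i, ((1 / (2 * (d : ℝ)) + if i = 0 then β else 0) * p i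
      + (1 / (2 * (d : ℝ)) - if i = 0 then β else 0) * m i)
      = 1 / (2 * (d : ℝ)) * (p i + m i) + if i = 0 then β * (p i - m i) else 0 := by
    intro i
    split_ifs <;> ring
  simp only [this, Finset.sum_add_distrib, Finset.sum_ite_eq', Finset.mem_univ, if_true, walkMean]

/-- All jump probabilities are strictly positive; the strictness is what yields the strong maximum
principle. -/
lemma rate_pos {β : ℝ} (hβ : |β| < 1 / (2 * (d : ℝ))) (i : Fin d) :
    0 < (1 / (2 * (d : ℝ)) + if i = 0 then β else 0) ∧
      0 < (1 / (2 * (d : ℝ)) - if i = 0 then β else 0) := by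
  have := abs_lt.1 hβ
  have hd := natCast_dim_pos (d := d)
  have : 0 < 1 / (2 * (d : ℝ)) := by positivity
  constructor <;> split_ifs <;> linarith

lemma walkMean_nonneg {β : ℝ} (hβ : |β| < 1 / (2 * (d : ℝ))) {p m : Fin d → ℝ}
    (hp : ∀ i, 0 ≤ p i) (hm : ∀ i, 0 ≤ m i) : 0 ≤ walkMean β p m := by
  rw [walkMean_eq_sum]
  exact Finset.sum_nonneg fun i _ =>
    add_nonneg (mul_nonneg (rate_pos hβ i).1.le (hp i)) (mul_nonneg (rate_pos hβ i).2.le (hm i))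

lemma eq_zero_of_walkMean_nonpos {β : ℝ} (hβ : |β| < 1 / (2 * (d : ℝ))) {p m : Fin d → ℝ}
    (hp : ∀ i, 0 ≤ p i) (hm : ∀ i, 0 ≤ m i) (h : walkMean β p m ≤ 0) (i : Fin d) :
    p i = 0 ∧ m i = 0 := by
  have hnn : ∀ i, 0 ≤ (1 / (2 * (d : ℝ)) + if i = 0 then β else 0) * p i
      + (1 / (2 * (d : ℝ)) - if i = 0 then β else 0) * m i := fun i =>
    add_nonneg (mul_nonneg (rate_pos hβ i).1.le (hp i)) (mul_nonneg (rate_pos hβ i).2.le (hm i))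
  have h0 := le_antisymm h (walkMean_nonneg hβ hp hm)
  rw [walkMean_eq_sum, Finset.sum_eq_zero_iff_of_nonneg fun i _ => hnn i] at h0
  have hi := h0 i (Finset.mem_univ i)
  have h1 := mul_nonneg (rate_pos hβ i).1.le (hp i)
  have h2 := mul_nonneg (rate_pos hβ i).2.le (hm i)
  constructor
  · exact (mul_eq_zero.1 (by linarith : (1 / (2 * (d : ℝ)) + if i = 0 then β else 0) * p i = 0)
      ).resolve_left (rate_pos hβ i).1.ne'
  · exact (mul_eq_zero.1 (by linarith : (1 / (2 * (d : ℝ)) - if i = 0 then β else 0) * m i = 0)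
      ).resolve_left (rate_pos hβ i).2.ne'

lemma const_sub_walkMean (β c : ℝ) (p m : Fin d → ℝ) :
    walkMean β (fun i => c - p i) (fun i => c - m i) = c - walkMean β p m := by
  have h := walkMean_add β (fun _ => c) (fun _ => c) (fun i => -1 * p i) (fun i => -1 * m i)
  rw [walkMean_const, walkMean_mul] at h
  simp only [sub_eq_add_neg]
  simpa using h

lemma abs_walkMean_le {β : ℝ} (hβ : |β| < 1 / (2 * (d : ℝ))) {p m : Fin d → ℝ} {K : ℝ}
    (hp : ∀ i, |p i| ≤ K) (hm : ∀ i, |m i| ≤ K) : |walkMean β p m| ≤ K := by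
  rw [abs_le]
  constructor
  · have h' := walkMean_nonneg hβ (p := fun i => K + p i) (m := fun i => K + m i)
      (fun i => by linarith [(abs_le.1 (hp i)).1]) (fun i => by linarith [(abs_le.1 (hm i)).1])
    rw [walkMean_add, walkMean_const] at h'
    linarith
  · have h' := walkMean_nonneg hβ (p := fun i => K - p i) (m := fun i => K - m i)
      (fun i => by linarith [(abs_le.1 (hp i)).2]) (fun i => by linarith [(abs_le.1 (hm i)).2])
    rw [const_sub_walkMean] at h'
    linarith

end WalkMean

/-! ### The environment chain: Fredholm alternative, reflection symmetry, correctors. -/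

section Environment

variable {d : ℕ} [NeZero d] {Y : Type*} [AddAction (Fin d → ℤ) Y]

variable (d) in
/-- The generator of the environment seen from the walk. -/
noncomputable def envGenerator (b : Y → ℝ) : (Y → ℝ) →ₗ[ℝ] (Y → ℝ) where
  toFun ψ y := walkMean (b y) (fun i : Fin d => ψ (latticeVec i +ᵥ y)) (fun i => ψ (-latticeVec i +ᵥ y))
    - ψ y
  map_add' ψ φ := by
    ext y
    simp only [Pi.add_apply, walkMean_add]
    ring
  map_smul' c ψ := by
    ext y
    have h := walkMean_mul (b y) c (fun i : Fin d => ψ (latticeVec i +ᵥ y))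
      (fun i => ψ (-latticeVec i +ᵥ y))
    simp only [Pi.smul_apply, smul_eq_mul, RingHom.id_apply, h]
    ring

lemma envGenerator_apply (b ψ : Y → ℝ) (y : Y) :
    envGenerator d b ψ y = walkMean (b y) (fun i : Fin d => ψ (latticeVec i +ᵥ y))
      (fun i => ψ (-latticeVec i +ᵥ y)) - ψ y := rfl

/-- The mean displacement of `χ` in direction `j` during one step of the walk. -/
noncomputable def corrFlux (b χ : Y → ℝ) (j : Fin d) (y : Y) : ℝ :=
  1 / (2 * (d : ℝ)) * (χ (latticeVec j +ᵥ y) - χ (-latticeVec j +ᵥ y))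
    + if j = 0 then b y * (χ (latticeVec j +ᵥ y) + χ (-latticeVec j +ᵥ y)) else 0

omit [NeZero d] in
lemma latticeVec_generate (H : AddSubgroup (Fin d → ℤ)) (h : ∀ i, latticeVec i ∈ H)
    (n : Fin d → ℤ) : n ∈ H := by
  have hn : n = ∑ i, n i • latticeVec i := by
    ext k
    simp [latticeVec, Finset.sum_apply, Pi.single_apply]
  rw [hn]
  exact H.sum_mem fun i _ => H.zsmul_mem (h i) _

lemma envGenerator_const (b : Y → ℝ) (c : ℝ) : envGenerator d b (fun _ => c) = 0 := by
  ext y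
  simp [envGenerator_apply, walkMean_const]

section Finite

variable [Finite Y] {b : Y → ℝ} (hb : ∀ y, |b y| < 1 / (2 * (d : ℝ)))
  (htrans : ∀ y z : Y, ∃ n : Fin d → ℤ, n +ᵥ y = z)

include hb htrans

/-- Maximum principle: subharmonic functions of the environment are constant. -/
lemma eq_of_envGenerator_nonneg {ψ : Y → ℝ} (h : ∀ y, 0 ≤ envGenerator d b ψ y) (y z : Y) :
    ψ y = ψ z := by
  have : Nonempty Y := ⟨y⟩
  obtain ⟨y₀, hmax⟩ := Finite.exists_max ψ
  have step : ∀ y, ψ y = ψ y₀ → ∀ i : Fin d, ψ (latticeVec i +ᵥ y) = ψ y₀ ∧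
      ψ (-latticeVec i +ᵥ y) = ψ y₀ := by
    intro y hy i
    have h1 := h y
    rw [envGenerator_apply, hy] at h1
    have h2 := eq_zero_of_walkMean_nonpos (hb y) (p := fun i => ψ y₀ - ψ (latticeVec i +ᵥ y))
      (m := fun i => ψ y₀ - ψ (-latticeVec i +ᵥ y)) (fun i => sub_nonneg.2 (hmax _))
      (fun i => sub_nonneg.2 (hmax _)) (by rw [const_sub_walkMean]; linarith) i
    exact ⟨by linarith [h2.1], by linarith [h2.2]⟩
  -- The translations preserving the set of maximizers form a group; the equivalence in the carrier
  -- gives closure under negation. It contains the generators by `step`.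
  let H : AddSubgroup (Fin d → ℤ) :=
    { carrier := {n | ∀ y, ψ (n +ᵥ y) = ψ y₀ ↔ ψ y = ψ y₀}
      zero_mem' := fun y => by rw [zero_vadd]
      add_mem' := fun {m n} hm hn y => by rw [add_vadd, hm, hn]
      neg_mem' := fun {n} hn y => by rw [← hn (-n +ᵥ y), vadd_vadd]; simp }
  have hH : ∀ n, n ∈ H := latticeVec_generate H fun i y =>
    ⟨fun hy => by simpa [vadd_vadd] using (step _ hy i).2, fun hy => (step y hy i).1⟩
  have hall : ∀ y, ψ y = ψ y₀ := by
    intro y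
    obtain ⟨n, rfl⟩ := htrans y₀ y
    exact (hH n y₀).2 rfl
  rw [hall y, hall z]

lemma envGenerator_eq_zero_of_nonneg {ψ : Y → ℝ} (h : ∀ y, 0 ≤ envGenerator d b ψ y) (y : Y) :
    envGenerator d b ψ y = 0 := by
  have hc : ψ = fun _ => ψ y := funext fun z => eq_of_envGenerator_nonneg hb htrans h z y
  rw [hc, envGenerator_const]
  rfl

lemma envGenerator_eq_zero_of_nonpos {ψ : Y → ℝ} (h : ∀ y, envGenerator d b ψ y ≤ 0) (y : Y) :
    envGenerator d b ψ y = 0 := by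
  have := envGenerator_eq_zero_of_nonneg hb htrans (ψ := -ψ)
    (fun z => by rw [map_neg]; simpa using h z) y
  rw [map_neg] at this
  simpa using this

/-- A constant in the range of the generator vanishes. -/
lemma eq_zero_of_envGenerator_eq_const [Nonempty Y] {ψ : Y → ℝ} {c : ℝ}
    (h : ∀ y, envGenerator d b ψ y = c) : c = 0 := by
  obtain ⟨y⟩ := ‹Nonempty Y›
  rcases le_total 0 c with hc | hc
  · rw [← h y]
    exact envGenerator_eq_zero_of_nonneg hb htrans (fun z => (h z).symm ▸ hc) y
  · rw [← h y]
    exact envGenerator_eq_zero_of_nonpos hb htrans (fun z => (h z).symm ▸ hc) y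

/-- Fredholm alternative: every function is, up to a constant, in the range of the generator. -/
lemma exists_envGenerator_eq [Nonempty Y] (h : Y → ℝ) :
    ∃ (c : ℝ) (ψ : Y → ℝ), ∀ y, envGenerator d b ψ y = h y - c := by
  obtain ⟨y₀⟩ := ‹Nonempty Y›
  -- Adding evaluation at `y₀` removes the constants from the kernel. In finite dimension
  -- injectivity gives surjectivity, and the constant is c = ψ(y₀).
  let T : (Y → ℝ) →ₗ[ℝ] (Y → ℝ) :=
    envGenerator d b + LinearMap.pi fun _ => LinearMap.proj y₀
  have hT : ∀ ψ y, T ψ y = envGenerator d b ψ y + ψ y₀ := fun ψ y => rfl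
  have hinj : Function.Injective T := by
    rw [injective_iff_map_eq_zero]
    intro ψ hψ
    have h1 : ∀ y, envGenerator d b ψ y = -ψ y₀ := fun y => by
      have := congrFun hψ y
      rw [hT] at this
      simp only [Pi.zero_apply] at this
      linarith
    have : Nonempty Y := ⟨y₀⟩
    have h2 := eq_zero_of_envGenerator_eq_const hb htrans h1
    ext y
    rw [eq_of_envGenerator_nonneg hb htrans (ψ := ψ) (fun z => by rw [h1, h2]) y y₀]
    simpa using h2
  obtain ⟨ψ, hψ⟩ := (LinearMap.injective_iff_surjective.1 hinj) h
  exact ⟨ψ y₀, ψ, fun y => by rw [← hψ, hT]; ring⟩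

/-- Here c plays the role of the mean of h: a nonnegative function with nonpositive mean vanishes.
-/
lemma eq_zero_of_envGenerator_eq_sub {ψ h : Y → ℝ} {c : ℝ} (hh : ∀ y, 0 ≤ h y)
    (hψ : ∀ y, envGenerator d b ψ y = h y - c) (hc : c ≤ 0) (y : Y) : h y = 0 := by
  have h1 := envGenerator_eq_zero_of_nonneg hb htrans (ψ := ψ)
    (fun z => by rw [hψ]; linarith [hh z]) y
  rw [hψ] at h1
  linarith [hh y]

section Reflection

variable {S : Y → Y} (hSb : ∀ y, b (S y) = -b y)
  (hS : ∀ (n : Fin d → ℤ) y, S (n +ᵥ y) = reflect n +ᵥ S y)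

omit hb htrans [Finite Y] in
lemma reflect_latticeVec_zero : reflect (latticeVec (0 : Fin d)) = -latticeVec 0 := by
  ext k
  rcases eq_or_ne k 0 with rfl | hk
  · simp [reflect, latticeVec]
  · simp [reflect, latticeVec, hk]

omit hb htrans [Finite Y] in
lemma reflect_latticeVec {i : Fin d} (hi : i ≠ 0) : reflect (latticeVec i) = latticeVec i := by
  ext k
  rcases eq_or_ne k 0 with rfl | hk
  · simp [reflect, latticeVec, hi]
  · simp [reflect, hk]

omit hb htrans [Finite Y] in
lemma reflect_neg (n : Fin d → ℤ) : reflect (-n) = -reflect n := by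
  ext k
  rcases eq_or_ne k 0 with rfl | hk
  · simp [reflect]
  · simp [reflect, hk]

include hSb hS

-- The reflection exchanges the steps e₁ and -e₁ and also flips the drift, so the jump probabilities
-- are preserved.
omit hb htrans [Finite Y] in
lemma envGenerator_comp_reflection (ψ : Y → ℝ) (y : Y) :
    envGenerator d b (fun z => ψ (S z)) y = envGenerator d b ψ (S y) := by
  simp only [envGenerator_apply, walkMean_eq_sum, hS, hSb, reflect_neg]
  congr 1
  refine Finset.sum_congr rfl fun i _ => ?_
  rcases eq_or_ne i 0 with rfl | hi
  · simp only [reflect_latticeVec_zero, if_true, neg_neg]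
    ring
  · simp only [reflect_latticeVec hi, if_neg hi]

/-- The mean of a function that is odd under the reflection vanishes. -/
lemma eq_zero_of_reflection_odd [Nonempty Y] {h ψ : Y → ℝ} {c : ℝ} (hh : ∀ y, h (S y) = -h y)
    (hψ : ∀ y, envGenerator d b ψ y = h y - c) : c = 0 := by
  -- Symmetrizing ψ cancels the odd part h and leaves a constant in the range.
  have h1 : ∀ y, envGenerator d b (ψ + fun z => ψ (S z)) y = -2 * c := fun y => by
    rw [map_add, Pi.add_apply, envGenerator_comp_reflection hSb hS, hψ, hψ, hh]
    ring
  have := eq_zero_of_envGenerator_eq_const hb htrans h1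
  linarith

/-- The corrector changes sign under the reflection, up to a constant. -/
lemma exists_reflection_corrector {χ : Y → ℝ} (hχ : ∀ y, envGenerator d b χ y = -2 * b y) (y₀ : Y) :
    ∀ y, χ (S y) = (χ y₀ + χ (S y₀)) - χ y := by
  intro y
  have h1 : ∀ y, envGenerator d b (χ + fun z => χ (S z)) y = 0 := fun y => by
    rw [map_add, Pi.add_apply, envGenerator_comp_reflection hSb hS, hχ, hχ, hSb]
    ring
  have h2 := eq_of_envGenerator_nonneg hb htrans (fun z => (h1 z).ge) y y₀
  simp only [Pi.add_apply] at h2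
  linarith

end Reflection

omit hb htrans [Finite Y] in
/-- The carré du champ of `x₁ + χ`. -/
lemma energy_identity {χ : Y → ℝ} (hχ : ∀ y, envGenerator d b χ y = -2 * b y) (y : Y) :
    1 / 2 * walkMean (b y)
      (fun i : Fin d => ((if i = 0 then 1 else 0) + χ (latticeVec i +ᵥ y) - χ y) ^ 2)
      (fun i => (-(if i = 0 then 1 else 0) + χ (-latticeVec i +ᵥ y) - χ y) ^ 2)
    = 1 / (2 * (d : ℝ)) + corrFlux b χ (0 : Fin d) y + 1 / 2 * envGenerator d b (fun z => χ z ^ 2) y := by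
  -- The squares are split so that linearity applies: an even indicator, a cross term that produces
  -- the flux, χ², and terms handled by the corrector equation.
  have e1 : ∀ i : Fin d, ((if i = 0 then (1 : ℝ) else 0) + χ (latticeVec i +ᵥ y) - χ y) ^ 2
      = (((if i = 0 then 1 else 0) + 2 * (if i = 0 then χ (latticeVec i +ᵥ y) - χ y else 0))
        + χ (latticeVec i +ᵥ y) ^ 2) + (-2 * χ y * χ (latticeVec i +ᵥ y) + χ y ^ 2) := by
    intro i; split_ifs <;> ring
  have e2 : ∀ i : Fin d, (-(if i = 0 then (1 : ℝ) else 0) + χ (-latticeVec i +ᵥ y) - χ y) ^ 2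
      = (((if i = 0 then 1 else 0) + 2 * (if i = 0 then -(χ (-latticeVec i +ᵥ y) - χ y) else 0))
        + χ (-latticeVec i +ᵥ y) ^ 2) + (-2 * χ y * χ (-latticeVec i +ᵥ y) + χ y ^ 2) := by
    intro i; split_ifs <;> ring
  have h := hχ y
  simp only [e1, e2, walkMean_add, walkMean_mul, walkMean_const]
  rw [envGenerator_apply] at h
  have h' : walkMean (b y) (fun i : Fin d => χ (latticeVec i +ᵥ y)) (fun i => χ (-latticeVec i +ᵥ y))
      = χ y - 2 * b y := by linarith
  rw [h', walkMean_even, envGenerator_apply]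
  have h3 : walkMean (b y)
      (fun i : Fin d => if i = 0 then χ (latticeVec i +ᵥ y) - χ y else 0)
      (fun i : Fin d => if i = 0 then -(χ (-latticeVec i +ᵥ y) - χ y) else 0)
      = corrFlux b χ (0 : Fin d) y - 2 * b y * χ y := by
    rw [walkMean_eq_sum, Finset.sum_eq_single (0 : Fin d)]
    · simp only [if_true, corrFlux]
      ring
    · intro i _ hi
      simp [hi]
    · simp
  rw [h3]
  have h4 : ∑ i : Fin d, 1 / (2 * (d : ℝ)) * (2 * if i = 0 then (1 : ℝ) else 0)
      = 2 * (1 / (2 * (d : ℝ))) := by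
    simp [Finset.sum_ite_eq']
    ring
  rw [h4]
  ring

end Finite

/-- The first and second order correctors, and the positive effective diffusivity. -/
theorem exists_correctors [Finite Y] [Nonempty Y] {b : Y → ℝ}
    (hb : ∀ y, |b y| < 1 / (2 * (d : ℝ)))
    (htrans : ∀ y z : Y, ∃ n : Fin d → ℤ, n +ᵥ y = z)
    {S : Y → Y} (hSb : ∀ y, b (S y) = -b y)
    (hS : ∀ (n : Fin d → ℤ) y, S (n +ᵥ y) = reflect n +ᵥ S y) :
    ∃ (q : ℝ) (χ : Y → ℝ) (ψ : Fin d → Y → ℝ), 0 < q ∧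
      (∀ y, envGenerator d b χ y = -2 * b y) ∧
      ∀ j y, envGenerator d b (ψ j) y
        = (if j = 0 then q - 1 / (2 * (d : ℝ)) else 0) - corrFlux b χ j y := by
  obtain ⟨c, χ, hχc⟩ := exists_envGenerator_eq hb htrans fun y => -2 * b y
  have hc : c = 0 := eq_zero_of_reflection_odd hb htrans hSb hS
    (fun y => by rw [hSb]; ring) hχc
  have hχ : ∀ y, envGenerator d b χ y = -2 * b y := fun y => by rw [hχc, hc, sub_zero]
  have hflux := fun j : Fin d => exists_envGenerator_eq hb htrans (corrFlux b χ j)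
  choose c ψ hψ using hflux
  -- For j ≠ 0 the flux is a difference of values of χ at two neighbours. The additive constant in
  -- the reflection rule for χ cancels, so the flux is odd.
  have hodd : ∀ j, j ≠ 0 → c j = 0 := by
    intro j hj
    obtain ⟨y₀⟩ := ‹Nonempty Y›
    have hχS := exists_reflection_corrector hb htrans hSb hS hχ y₀
    have : Nonempty Y := ⟨y₀⟩
    refine eq_zero_of_reflection_odd hb htrans hSb hS (fun y => ?_) (hψ j)
    have e1 : latticeVec j +ᵥ S y = S (latticeVec j +ᵥ y) := by rw [hS, reflect_latticeVec hj]
    have e2 : -latticeVec j +ᵥ S y = S (-latticeVec j +ᵥ y) := by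
      rw [hS, reflect_neg, reflect_latticeVec hj]
    simp only [corrFlux, if_neg hj, e1, e2, hχS (latticeVec j +ᵥ y), hχS (-latticeVec j +ᵥ y)]
    ring
  refine ⟨1 / (2 * (d : ℝ)) + c 0, χ, fun j y => -ψ j y, ?_, hχ, fun j y => ?_⟩
  · by_contra! hq
    -- The squared gradient of x₁ + χ differs from its mean q by an element of the range of the
    -- generator. If q ≤ 0 it vanishes identically, so χ decreases by 1 along e₁, which fails at a
    -- minimum of χ.
    have hE := eq_zero_of_envGenerator_eq_sub hb htrans
      (ψ := (1 / 2 : ℝ) • (fun z => χ z ^ 2) + ψ 0)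
      (h := fun y => 1 / 2 * walkMean (b y)
        (fun i : Fin d => ((if i = 0 then 1 else 0) + χ (latticeVec i +ᵥ y) - χ y) ^ 2)
        (fun i => (-(if i = 0 then 1 else 0) + χ (-latticeVec i +ᵥ y) - χ y) ^ 2))
      (fun y => mul_nonneg (by norm_num)
        (walkMean_nonneg (hb y) (fun i => sq_nonneg _) (fun i => sq_nonneg _)))
      (fun y => by
        rw [energy_identity hχ y, map_add, map_smul, Pi.add_apply, hψ 0, Pi.smul_apply,
          smul_eq_mul]
        ring) hq
    obtain ⟨y, hmin⟩ := Finite.exists_min χ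
    have h1 := (eq_zero_of_walkMean_nonpos (hb y) (fun i => sq_nonneg _) (fun i => sq_nonneg _)
      (by linarith [hE y]) (0 : Fin d)).1
    have h2 := pow_eq_zero_iff (two_ne_zero) |>.1 h1
    simp only [if_true] at h2
    linarith [hmin (latticeVec (0 : Fin d) +ᵥ y)]
  · have h1 : (fun y => -ψ j y) = -ψ j := rfl
    simp only [h1]
    rw [map_neg, Pi.neg_apply, hψ]
    split_ifs with hj
    · rw [hj]; ring
    · rw [hodd j hj]; ring

end Environment

/-! ### The resolvent equation on the lattice. -/

section Lattice

variable {d : ℕ} [NeZero d]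

/-- Maximum principle for the resolvent equation on the lattice. -/
theorem abs_le_of_lattice_equation {β : (Fin d → ℤ) → ℝ} (hβ : ∀ n, |β n| < 1 / (2 * (d : ℝ)))
    {ε : ℝ} (hε : 0 < ε) {v r : (Fin d → ℤ) → ℝ} (hv : ∃ C, ∀ n, |v n| ≤ C)
    (heq : ∀ n, v n - walkMean (β n) (fun i => v (n + latticeVec i))
      (fun i => v (n - latticeVec i)) + ε ^ 2 * v n = r n)
    {M : ℝ} (hr : ∀ n, |r n| ≤ ε ^ 2 * M) (n : Fin d → ℤ) : |v n| ≤ M := by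
  obtain ⟨C, hC⟩ := hv
  have hbdd : BddAbove (Set.range fun n => |v n|) := ⟨C, by rintro _ ⟨m, rfl⟩; exact hC m⟩
  set s := ⨆ m, |v m| with hs
  have hle : ∀ m, |v m| ≤ s := fun m => le_ciSup hbdd m
  have hε2 : 0 < ε ^ 2 := by positivity
  have h1 : ∀ m, |v m| ≤ (s + ε ^ 2 * M) / (1 + ε ^ 2) := by
    intro m
    rw [le_div_iff₀ (by positivity)]
    have h2 : v m * (1 + ε ^ 2) = walkMean (β m) (fun i => v (m + latticeVec i))
      (fun i => v (m - latticeVec i)) + r m := by linarith [heq m]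
    calc |v m| * (1 + ε ^ 2) = |v m * (1 + ε ^ 2)| := by
          rw [abs_mul, abs_of_pos (by positivity : 0 < 1 + ε ^ 2)]
      _ ≤ s + ε ^ 2 * M := by
          rw [h2]
          exact (abs_add_le _ _).trans
            (add_le_add (abs_walkMean_le (hβ m) (fun i => hle _) fun i => hle _) (hr m))
  -- The supremum need not be attained, so the pointwise bound is passed to it; (1 + ε²)s ≤ s + ε²M
  -- then gives s ≤ M.
  have h3 : s ≤ (s + ε ^ 2 * M) / (1 + ε ^ 2) := ciSup_le h1
  rw [le_div_iff₀ (by positivity)] at h3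
  have h4 : s ≤ M := by nlinarith
  exact (hle n).trans h4

/-- Averaging does not increase the sup norm, so the fixed-point map contracts by the factor 1/(1 +
ε²) on bounded functions. -/
theorem exists_lattice_solution {β : (Fin d → ℤ) → ℝ} (hβ : ∀ n, |β n| < 1 / (2 * (d : ℝ)))
    {ε : ℝ} (hε : 0 < ε) {g : (Fin d → ℤ) → ℝ} {M : ℝ} (hg : ∀ n, |g n| ≤ M) :
    ∃ v : (Fin d → ℤ) → ℝ, (∀ n, |v n| ≤ M) ∧
      ∀ n, v n - walkMean (β n) (fun i => v (n + latticeVec i))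
        (fun i => v (n - latticeVec i)) + ε ^ 2 * v n = ε ^ 2 * g n := by
  have hε2 : 0 < ε ^ 2 := by positivity
  let T : BoundedContinuousFunction (Fin d → ℤ) ℝ → BoundedContinuousFunction (Fin d → ℤ) ℝ :=
    fun v => BoundedContinuousFunction.ofNormedAddCommGroupDiscrete
      (fun n => (1 + ε ^ 2)⁻¹ * (walkMean (β n) (fun i => v (n + latticeVec i))
        (fun i => v (n - latticeVec i)) + ε ^ 2 * g n))
      ((1 + ε ^ 2)⁻¹ * (‖v‖ + ε ^ 2 * M)) (fun n => by
        rw [Real.norm_eq_abs, abs_mul, abs_of_pos (by positivity : 0 < (1 + ε ^ 2)⁻¹)]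
        refine mul_le_mul_of_nonneg_left ((abs_add_le _ _).trans (add_le_add ?_ ?_))
          (by positivity)
        · exact abs_walkMean_le (hβ n) (fun i => v.norm_coe_le_norm _)
            fun i => v.norm_coe_le_norm _
        · rw [abs_mul, abs_of_pos hε2]
          exact mul_le_mul_of_nonneg_left (hg n) hε2.le)
  have hTapply : ∀ v n, T v n = (1 + ε ^ 2)⁻¹ * (walkMean (β n) (fun i => v (n + latticeVec i))
        (fun i => v (n - latticeVec i)) + ε ^ 2 * g n) := fun v n => rfl
  have hT : ContractingWith (Real.toNNReal (1 + ε ^ 2)⁻¹) T := by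
    refine ⟨?_, LipschitzWith.of_dist_le_mul fun v w => ?_⟩
    · rw [Real.toNNReal_lt_one]
      exact inv_lt_one_of_one_lt₀ (by linarith)
    · rw [Real.coe_toNNReal _ (by positivity)]
      refine (BoundedContinuousFunction.dist_le (by positivity)).2 fun n => ?_
      have h1 := walkMean_add (β n) (fun i => w (n + latticeVec i)) (fun i => w (n - latticeVec i))
        (fun i => v (n + latticeVec i) - w (n + latticeVec i))
        (fun i => v (n - latticeVec i) - w (n - latticeVec i))
      simp only [add_sub_cancel] at h1
      rw [hTapply, hTapply, Real.dist_eq, h1, ← mul_sub, abs_mul,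
        abs_of_pos (by positivity : 0 < (1 + ε ^ 2)⁻¹)]
      refine mul_le_mul_of_nonneg_left ?_ (by positivity)
      have h2 : ∀ m, |v m - w m| ≤ dist v w := fun m => by
        rw [← Real.dist_eq]
        exact BoundedContinuousFunction.dist_coe_le_dist m
      rw [add_sub_add_right_eq_sub, add_sub_cancel_left]
      exact abs_walkMean_le (hβ n) (fun i => h2 _) fun i => h2 _
  set v := hT.fixedPoint T
  have heq : ∀ n, v n - walkMean (β n) (fun i => v (n + latticeVec i))
        (fun i => v (n - latticeVec i)) + ε ^ 2 * v n = ε ^ 2 * g n := by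
    intro n
    have h1 : v n = (1 + ε ^ 2)⁻¹ * (walkMean (β n) (fun i => v (n + latticeVec i))
        (fun i => v (n - latticeVec i)) + ε ^ 2 * g n) := by
      rw [← hTapply v n]
      exact congrArg (fun u : BoundedContinuousFunction (Fin d → ℤ) ℝ => u n)
        hT.fixedPoint_isFixedPt.symm
    have h2 : (1 + ε ^ 2) * v n = walkMean (β n) (fun i => v (n + latticeVec i))
        (fun i => v (n - latticeVec i)) + ε ^ 2 * g n := by
      conv_lhs => rw [h1]
      rw [mul_inv_cancel_left₀ (by positivity)]
    linarith
  refine ⟨v, abs_le_of_lattice_equation hβ hε ⟨‖v‖, fun n => v.norm_coe_le_norm n⟩ heq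
    fun n => ?_, heq⟩
  rw [abs_mul, abs_of_pos hε2]
  exact mul_le_mul_of_nonneg_left (hg n) hε2.le

end Lattice

/-! ### Uniform Taylor bounds along coordinate directions. -/

section Taylor

open scoped SchwartzMap LineDeriv

variable {d : ℕ}

/-- Each application raises the Taylor order by one. The mean value inequality keeps C instead of
the sharp C/(k+1), which is enough here. -/
lemma abs_sub_le_of_hasDerivAt {φ φ' : ℝ → ℝ} (hφ : ∀ s, HasDerivAt φ (φ' s) s) {C : ℝ}
    (hC : 0 ≤ C) {k : ℕ} (hb : ∀ s, |φ' s| ≤ C * |s| ^ k) (t : ℝ) :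
    |φ t - φ 0| ≤ C * |t| ^ (k + 1) := by
  have h := Convex.norm_image_sub_le_of_norm_hasDerivWithin_le (f := φ) (f' := φ')
    (s := Set.uIcc 0 t) (C := C * |t| ^ k) (x := 0) (y := t)
    (fun s _ => (hφ s).hasDerivWithinAt)
    (fun s hs => by
      have h1 : |s| ≤ |t| := by simpa using Set.abs_sub_left_of_mem_uIcc hs
      refine (hb s).trans (mul_le_mul_of_nonneg_left ?_ hC)
      gcongr)
    (convex_uIcc 0 t) Set.left_mem_uIcc Set.right_mem_uIcc
  simp only [Real.norm_eq_abs, sub_zero] at h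
  rw [pow_succ, ← mul_assoc]
  exact h

variable (w : 𝓢(EuclideanSpace ℝ (Fin d), ℝ))

/-- The partial derivative of a Schwartz function, as a Schwartz function. -/
noncomputable def schwartzPartial (j : Fin d) : 𝓢(EuclideanSpace ℝ (Fin d), ℝ) :=
  ∂_{EuclideanSpace.single j (1 : ℝ)} w

lemma coe_schwartzPartial (j : Fin d) : ⇑(schwartzPartial w j) = partialDeriv j ⇑w := rfl

lemma schwartz_hasDerivAt_along (j : Fin d) (x : EuclideanSpace ℝ (Fin d)) (t : ℝ) :
    HasDerivAt (fun s : ℝ => w (x + s • EuclideanSpace.single j 1))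
      (schwartzPartial w j (x + t • EuclideanSpace.single j 1)) t :=
  hasDerivAt_along_line w.differentiable j x t

lemma schwartz_taylor_zero (j : Fin d) : ∃ C, 0 ≤ C ∧ ∀ x (t : ℝ),
    |w (x + t • EuclideanSpace.single j 1) - w x| ≤ C * |t| := by
  obtain ⟨C, hC, h⟩ := schwartz_exists_bound (schwartzPartial w j)
  refine ⟨C, hC, fun x t => ?_⟩
  simpa using abs_sub_le_of_hasDerivAt (k := 0) (schwartz_hasDerivAt_along w j x) hC
    (fun s => by simpa using h _) t

lemma schwartz_taylor_one (j : Fin d) : ∃ C, 0 ≤ C ∧ ∀ x (t : ℝ),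
    |w (x + t • EuclideanSpace.single j 1) - w x - t * schwartzPartial w j x| ≤ C * |t| ^ 2 := by
  obtain ⟨C, hC, h⟩ := schwartz_taylor_zero (schwartzPartial w j) j
  refine ⟨C, hC, fun x t => ?_⟩
  have := abs_sub_le_of_hasDerivAt (k := 1)
    (φ := fun s => w (x + s • EuclideanSpace.single j 1) - s * schwartzPartial w j x)
    (fun s => (schwartz_hasDerivAt_along w j x s).sub
      ((hasDerivAt_id s).mul_const (schwartzPartial w j x))) hC
    (fun s => by simpa using h x s) t
  simp only [zero_smul, add_zero, zero_mul, sub_zero] at this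
  rwa [sub_right_comm]

lemma schwartz_taylor_two (j : Fin d) : ∃ C, 0 ≤ C ∧ ∀ x (t : ℝ),
    |w (x + t • EuclideanSpace.single j 1) - w x - t * schwartzPartial w j x
      - t ^ 2 / 2 * schwartzPartial (schwartzPartial w j) j x| ≤ C * |t| ^ 3 := by
  obtain ⟨C, hC, h⟩ := schwartz_taylor_one (schwartzPartial w j) j
  refine ⟨C, hC, fun x t => ?_⟩
  have := abs_sub_le_of_hasDerivAt (k := 2)
    (φ := fun s => w (x + s • EuclideanSpace.single j 1) - s * schwartzPartial w j x
      - s ^ 2 / 2 * schwartzPartial (schwartzPartial w j) j x)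
    (φ' := fun s => schwartzPartial w j (x + s • EuclideanSpace.single j 1)
      - schwartzPartial w j x - s * schwartzPartial (schwartzPartial w j) j x)
    (fun s => by
      have h1 := (hasDerivAt_id s).mul_const (schwartzPartial w j x)
      have h2 := ((hasDerivAt_pow 2 s).div_const 2).mul_const
        (schwartzPartial (schwartzPartial w j) j x)
      refine (((schwartz_hasDerivAt_along w j x s).sub h1).sub h2).congr_deriv ?_
      simp) hC (fun s => h x s) t
  simp only [zero_smul, add_zero, zero_mul, sub_zero, ne_eq, OfNat.ofNat_ne_zero,
    not_false_eq_true, zero_pow, zero_div] at this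
  convert this using 2
  ring

lemma exists_uniform_const {ι : Type*} [Fintype ι] {P : ι → ℝ → Prop}
    (hmono : ∀ i C C', C ≤ C' → P i C → P i C') (h : ∀ i, ∃ C, 0 ≤ C ∧ P i C) :
    ∃ C, 0 ≤ C ∧ ∀ i, P i C := by
  choose C hC hP using h
  exact ⟨∑ i, C i, Finset.sum_nonneg fun i _ => hC i, fun i => hmono i _ _
    (Finset.single_le_sum (fun i _ => hC i) (Finset.mem_univ i)) (hP i)⟩

end Taylor

/-! ### The two-scale expansion and its error. -/

section Expansion

open scoped SchwartzMap LineDeriv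

variable {d : ℕ} [NeZero d] {Y : Type*} [AddAction (Fin d → ℤ) Y] [Finite Y] {b : Y → ℝ}
  (hb : ∀ y, |b y| < 1 / (2 * (d : ℝ))) (w : 𝓢(EuclideanSpace ℝ (Fin d), ℝ))

omit [NeZero d] [AddAction (Fin d → ℤ) Y] in
lemma exists_abs_le (a : Y → ℝ) : ∃ A, 0 ≤ A ∧ ∀ y, |a y| ≤ A := by
  have := Fintype.ofFinite Y
  exact ⟨∑ y, |a y|, Finset.sum_nonneg fun y _ => abs_nonneg _, fun y =>
    Finset.single_le_sum (f := fun y => |a y|) (fun y _ => abs_nonneg _) (Finset.mem_univ y)⟩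

/-- The increment of `a w` over one step of the walk with step size `ε`, from the environment `y`
and the position `x`. -/
noncomputable def stepIncrement (b a : Y → ℝ) (g : EuclideanSpace ℝ (Fin d) → ℝ) (ε : ℝ) (y : Y)
    (x : EuclideanSpace ℝ (Fin d)) : ℝ :=
  walkMean (b y) (fun i : Fin d => a (latticeVec i +ᵥ y) * g (x + ε • EuclideanSpace.single i 1))
    (fun i => a (-latticeVec i +ᵥ y) * g (x + (-ε) • EuclideanSpace.single i 1)) - a y * g x

include hb

/-- In the ansatz a term with prefactor ε^k must be expanded with error O(ε^(3-k)). This is the case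
k = 2; the next two lemmas treat k = 1 and k = 0. -/
lemma stepIncrement_expand_zero (a : Y → ℝ) : ∃ C, 0 ≤ C ∧ ∀ ε > 0, ∀ y x,
    |stepIncrement b a w ε y x - envGenerator d b a y * w x| ≤ C * ε := by
  obtain ⟨A, hA, ha⟩ := exists_abs_le a
  obtain ⟨C, hC, h⟩ := exists_uniform_const
    (fun i C C' hCC h x t => (h x t).trans (mul_le_mul_of_nonneg_right hCC (abs_nonneg t)))
    (schwartz_taylor_zero w)
  refine ⟨A * C, by positivity, fun ε hε y x => ?_⟩
  have e := walkMean_add (b y)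
    (fun i : Fin d => w x * a (latticeVec i +ᵥ y)) (fun i => w x * a (-latticeVec i +ᵥ y))
    (fun i => a (latticeVec i +ᵥ y) * (w (x + ε • EuclideanSpace.single i 1) - w x))
    (fun i => a (-latticeVec i +ᵥ y) * (w (x + (-ε) • EuclideanSpace.single i 1) - w x))
  rw [walkMean_mul] at e
  have e1 : ∀ p q : ℝ, w x * p + p * (q - w x) = p * q := fun p q => by ring
  simp only [e1] at e
  have e2 : ∀ m p r z : ℝ, m * p + r - z * m - (p - z) * m = r := fun m p r z => by ring
  rw [stepIncrement, e, envGenerator_apply, e2]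
  refine abs_walkMean_le (hb y) (fun i => ?_) fun i => ?_
  all_goals
    rw [abs_mul, mul_assoc]
    refine mul_le_mul (ha _) ((h i x _).trans_eq ?_) (abs_nonneg _) hA
    simp only [abs_neg, abs_of_pos hε]

lemma stepIncrement_expand_one (a : Y → ℝ) : ∃ C, 0 ≤ C ∧ ∀ ε > 0, ∀ y x,
    |stepIncrement b a w ε y x - (envGenerator d b a y * w x
      + ε * ∑ j, corrFlux b a j y * schwartzPartial w j x)| ≤ C * ε ^ 2 := by
  obtain ⟨A, hA, ha⟩ := exists_abs_le a
  obtain ⟨C, hC, h⟩ := exists_uniform_const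
    (fun i C C' hCC h x t => (h x t).trans (mul_le_mul_of_nonneg_right hCC (by positivity)))
    (schwartz_taylor_one w)
  refine ⟨A * C, by positivity, fun ε hε y x => ?_⟩
  have eflux : walkMean (b y) (fun i : Fin d => a (latticeVec i +ᵥ y) * schwartzPartial w i x)
      (fun i => -(a (-latticeVec i +ᵥ y) * schwartzPartial w i x))
      = ∑ j, corrFlux b a j y * schwartzPartial w j x := by
    rw [walkMean_eq_sum]
    refine Finset.sum_congr rfl fun i _ => ?_
    rw [corrFlux]
    split_ifs <;> ring
  have e := walkMean_add (b y)
    (fun i : Fin d => w x * a (latticeVec i +ᵥ y)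
      + ε * (a (latticeVec i +ᵥ y) * schwartzPartial w i x))
    (fun i => w x * a (-latticeVec i +ᵥ y)
      + ε * (-(a (-latticeVec i +ᵥ y) * schwartzPartial w i x)))
    (fun i => a (latticeVec i +ᵥ y) * (w (x + ε • EuclideanSpace.single i 1) - w x
      - ε * schwartzPartial w i x))
    (fun i => a (-latticeVec i +ᵥ y) * (w (x + (-ε) • EuclideanSpace.single i 1) - w x
      - -ε * schwartzPartial w i x))
  have e₀ : walkMean (b y) (fun i : Fin d => w x * a (latticeVec i +ᵥ y)
      + ε * (a (latticeVec i +ᵥ y) * schwartzPartial w i x))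
    (fun i => w x * a (-latticeVec i +ᵥ y)
      + ε * (-(a (-latticeVec i +ᵥ y) * schwartzPartial w i x)))
    = w x * walkMean (b y) (fun i : Fin d => a (latticeVec i +ᵥ y))
      (fun i => a (-latticeVec i +ᵥ y))
      + ε * ∑ j, corrFlux b a j y * schwartzPartial w j x := by
    rw [walkMean_add, walkMean_mul, walkMean_mul, eflux]
  rw [e₀] at e
  have e1 : ∀ p q r : ℝ, w x * p + ε * (p * r) + p * (q - w x - ε * r) = p * q :=
    fun p q r => by ring
  have e1' : ∀ p q r : ℝ, w x * p + ε * (-(p * r)) + p * (q - w x - -ε * r) = p * q :=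
    fun p q r => by ring
  simp only [e1, e1'] at e
  have e2 : ∀ m p r z t : ℝ, m * p + t + r - z * m - ((p - z) * m + t) = r :=
    fun m p r z t => by ring
  rw [stepIncrement, e, envGenerator_apply, e2]
  refine abs_walkMean_le (hb y) (fun i => ?_) fun i => ?_
  all_goals
    rw [abs_mul, mul_assoc]
    refine mul_le_mul (ha _) ((h i x _).trans_eq ?_) (abs_nonneg _) hA
    simp only [abs_neg, abs_of_pos hε]

-- Odd Taylor terms see only the drift, even ones only the symmetric part of the walk.
omit [Finite Y] in
lemma stepIncrement_expand_two : ∃ C, 0 ≤ C ∧ ∀ ε > 0, ∀ y x,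
    |stepIncrement b 1 w ε y x - (ε * (2 * b y * schwartzPartial w 0 x)
      + ε ^ 2 * ∑ j, 1 / (2 * (d : ℝ)) * schwartzPartial (schwartzPartial w j) j x)|
      ≤ C * ε ^ 3 := by
  obtain ⟨C, hC, h⟩ := exists_uniform_const
    (fun i C C' hCC h x t => (h x t).trans (mul_le_mul_of_nonneg_right hCC (by positivity)))
    (schwartz_taylor_two w)
  refine ⟨C, hC, fun ε hε y x => ?_⟩
  have e := walkMean_add (b y)
    (fun i : Fin d => w x + (ε * schwartzPartial w i x
      + ε ^ 2 * (1 / 2 * schwartzPartial (schwartzPartial w i) i x)))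
    (fun i => w x + (ε * -schwartzPartial w i x
      + ε ^ 2 * (1 / 2 * schwartzPartial (schwartzPartial w i) i x)))
    (fun i => w (x + ε • EuclideanSpace.single i 1) - w x - ε * schwartzPartial w i x
      - ε ^ 2 / 2 * schwartzPartial (schwartzPartial w i) i x)
    (fun i => w (x + (-ε) • EuclideanSpace.single i 1) - w x - -ε * schwartzPartial w i x
      - (-ε) ^ 2 / 2 * schwartzPartial (schwartzPartial w i) i x)
  have e₀ : walkMean (b y) (fun i : Fin d => w x + (ε * schwartzPartial w i x
      + ε ^ 2 * (1 / 2 * schwartzPartial (schwartzPartial w i) i x)))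
    (fun i => w x + (ε * -schwartzPartial w i x
      + ε ^ 2 * (1 / 2 * schwartzPartial (schwartzPartial w i) i x)))
    = w x + (ε * (2 * b y * schwartzPartial w 0 x) + ε ^ 2 * ∑ j, 1 / (2 * (d : ℝ))
      * (2 * (1 / 2 * schwartzPartial (schwartzPartial w j) j x))) := by
    rw [walkMean_add, walkMean_const, walkMean_add, walkMean_mul, walkMean_mul, walkMean_odd,
      walkMean_even]
  rw [e₀] at e
  have e1 : ∀ q r s : ℝ, w x + (ε * r + ε ^ 2 * (1 / 2 * s))
      + (q - w x - ε * r - ε ^ 2 / 2 * s) = 1 * q := fun q r s => by ring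
  have e1' : ∀ q r s : ℝ, w x + (ε * -r + ε ^ 2 * (1 / 2 * s))
      + (q - w x - -ε * r - (-ε) ^ 2 / 2 * s) = 1 * q := fun q r s => by ring
  have e1'' : ∀ s : ℝ, 2 * (1 / 2 * s) = s := fun s => by ring
  simp only [e1, e1', e1''] at e
  have e2 : ∀ m p r : ℝ, m + p + r - 1 * m - p = r := fun m p r => by ring
  simp only [stepIncrement, Pi.one_apply]
  rw [e, e2]
  refine abs_walkMean_le (hb y) (fun i => (h i x _).trans_eq ?_) fun i => (h i x _).trans_eq ?_
  all_goals simp only [abs_neg, abs_of_pos hε]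

omit [NeZero d] hb [AddAction (Fin d → ℤ) Y] [Finite Y] in
lemma latticePoint_add (ε : ℝ) (n : Fin d → ℤ) (i : Fin d) :
    latticePoint ε (n + latticeVec i) = latticePoint ε n + ε • EuclideanSpace.single i (1 : ℝ) := by
  ext k
  rcases eq_or_ne k i with rfl | hk
  · simp [latticePoint, latticeVec, mul_add]
  · simp [latticePoint, latticeVec, hk]

omit [NeZero d] hb [AddAction (Fin d → ℤ) Y] [Finite Y] in
lemma latticePoint_sub (ε : ℝ) (n : Fin d → ℤ) (i : Fin d) :
    latticePoint ε (n - latticeVec i)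
      = latticePoint ε n + (-ε) • EuclideanSpace.single i (1 : ℝ) := by
  ext k
  rcases eq_or_ne k i with rfl | hk
  · simp [latticePoint, latticeVec, mul_sub]
    ring
  · simp [latticePoint, latticeVec, hk]

omit hb [Finite Y] in
lemma walkMean_lattice (b a : Y → ℝ) (g : EuclideanSpace ℝ (Fin d) → ℝ) (ε : ℝ) (y : Y)
    (n : Fin d → ℤ) :
    walkMean (b (n +ᵥ y))
      (fun i => a ((n + latticeVec i) +ᵥ y) * g (latticePoint ε (n + latticeVec i)))
      (fun i => a ((n - latticeVec i) +ᵥ y) * g (latticePoint ε (n - latticeVec i)))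
    = stepIncrement b a g ε (n +ᵥ y) (latticePoint ε n) + a (n +ᵥ y) * g (latticePoint ε n) := by
  have h1 : ∀ i : Fin d, (n + latticeVec i) +ᵥ y = latticeVec i +ᵥ (n +ᵥ y) := fun i => by
    rw [vadd_vadd, add_comm]
  have h2 : ∀ i : Fin d, (n - latticeVec i) +ᵥ y = -latticeVec i +ᵥ (n +ᵥ y) := fun i => by
    rw [vadd_vadd, sub_eq_neg_add]
  simp only [stepIncrement, h1, h2, latticePoint_add, latticePoint_sub, sub_add_cancel]

/-- The two-scale expansion approximates lattice solutions with an error of order `ε`. -/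
theorem exists_homogenization_rate {q : ℝ} {χ : Y → ℝ} {ψ : Fin d → Y → ℝ}
    (hχ : ∀ y, envGenerator d b χ y = -2 * b y)
    (hψ : ∀ j y, envGenerator d b (ψ j) y
      = (if j = 0 then q - 1 / (2 * (d : ℝ)) else 0) - corrFlux b χ j y)
    {f : EuclideanSpace ℝ (Fin d) → ℝ} (hw : IsHomogenizedSolution q f w) :
    ∃ C, 0 ≤ C ∧ ∀ ε, 0 < ε → ε ≤ 1 → ∀ (y : Y) (v : (Fin d → ℤ) → ℝ), (∃ K, ∀ n, |v n| ≤ K) →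
      (∀ n, v n - walkMean (b (n +ᵥ y)) (fun i => v (n + latticeVec i))
        (fun i => v (n - latticeVec i)) + ε ^ 2 * v n = ε ^ 2 * f (latticePoint ε n)) →
      ∀ n, |v n - w (latticePoint ε n)| ≤ C * ε := by
  set w₀ := schwartzPartial w 0 with hw₀
  obtain ⟨C₀, hC₀, h₀⟩ := stepIncrement_expand_two hb w
  obtain ⟨C₁, hC₁, h₁⟩ := stepIncrement_expand_one hb w₀ χ
  obtain ⟨C₂, hC₂, h₂⟩ := exists_uniform_const
    (P := fun j C => ∀ ε > 0, ∀ y x, |stepIncrement b (ψ j) (schwartzPartial w₀ j) ε y x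
      - envGenerator d b (ψ j) y * schwartzPartial w₀ j x| ≤ C * ε)
    (fun i C C' hCC h ε hε y x =>
      (h ε hε y x).trans (mul_le_mul_of_nonneg_right hCC hε.le))
    (fun j => stepIncrement_expand_zero hb (schwartzPartial w₀ j) (ψ j))
  obtain ⟨B, hB, hχB⟩ := exists_abs_le χ
  obtain ⟨B₁, hB₁, hwB⟩ := schwartz_exists_bound w₀
  obtain ⟨B₂, hB₂, hψB⟩ := exists_uniform_const
    (P := fun j C => ∀ y, |ψ j y| ≤ C) (fun i C C' hCC h y => (h y).trans hCC)
    (fun j => exists_abs_le (ψ j))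
  obtain ⟨B₃, hB₃, hwwB⟩ := exists_uniform_const
    (P := fun j C => ∀ x, |schwartzPartial w₀ j x| ≤ C) (fun i C C' hCC h y => (h y).trans hCC)
    (fun j => schwartz_exists_bound (schwartzPartial w₀ j))
  obtain ⟨K₀, hK₀, hwK⟩ := schwartz_exists_bound w
  set D := B * B₁ + d * (B₂ * B₃) with hD
  have hD0 : 0 ≤ D := by positivity
  -- The first three constants come from the expansions, one D from the term ε² times the corrector
  -- part in the residual, the other D from replacing W by w.
  refine ⟨C₀ + C₁ + d * C₂ + D + D, by positivity, fun ε hε hε1 y v hv heq => ?_⟩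
  let corr : (Fin d → ℤ) → ℝ := fun n => ε * (χ (n +ᵥ y) * w₀ (latticePoint ε n))
    + ε ^ 2 * ∑ j, ψ j (n +ᵥ y) * schwartzPartial w₀ j (latticePoint ε n)
  have hcorr : ∀ n, |corr n| ≤ D * ε := by
    intro n
    have h1 : |∑ j, ψ j (n +ᵥ y) * schwartzPartial w₀ j (latticePoint ε n)| ≤ d * (B₂ * B₃) := by
      refine (Finset.abs_sum_le_sum_abs _ _).trans ?_
      refine (Finset.sum_le_card_nsmul _ _ (B₂ * B₃) fun j _ => ?_).trans_eq (by simp)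
      rw [abs_mul]
      exact mul_le_mul (hψB j _) (hwwB j _) (abs_nonneg _) hB₂
    have h2 : |χ (n +ᵥ y) * w₀ (latticePoint ε n)| ≤ B * B₁ := by
      rw [abs_mul]
      exact mul_le_mul (hχB _) (hwB _) (abs_nonneg _) hB
    have h3 : ε ^ 2 ≤ ε := by nlinarith
    calc |corr n| ≤ ε * (B * B₁) + ε ^ 2 * (d * (B₂ * B₃)) := by
          refine (abs_add_le _ _).trans (add_le_add ?_ ?_)
          · rw [abs_mul, abs_of_pos hε]
            exact mul_le_mul_of_nonneg_left h2 hε.le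
          · rw [abs_mul, abs_of_pos (by positivity : 0 < ε ^ 2)]
            exact mul_le_mul_of_nonneg_left h1 (by positivity)
      _ ≤ ε * (B * B₁) + ε * (d * (B₂ * B₃)) := by gcongr
      _ = D * ε := by rw [hD]; ring
  -- The factor 1 puts the leading term in the form a·g required by `walkMean_lattice`.
  let W : (Fin d → ℤ) → ℝ := fun n => (1 : Y → ℝ) (n +ᵥ y) * w (latticePoint ε n) + corr n
  have hWn : ∀ n, W n = w (latticePoint ε n) + corr n := fun n => by simp [W]
  have hmean : ∀ n, walkMean (b (n +ᵥ y)) (fun i => W (n + latticeVec i))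
      (fun i => W (n - latticeVec i)) - W n
      = stepIncrement b 1 w ε (n +ᵥ y) (latticePoint ε n)
        + (ε * stepIncrement b χ w₀ ε (n +ᵥ y) (latticePoint ε n)
        + ε ^ 2 * ∑ j, stepIncrement b (ψ j) (schwartzPartial w₀ j) ε (n +ᵥ y)
          (latticePoint ε n)) := by
    intro n
    simp only [W, corr]
    rw [walkMean_add, walkMean_add, walkMean_mul, walkMean_mul, walkMean_sum, walkMean_lattice,
      walkMean_lattice]
    simp only [walkMean_lattice, Finset.sum_add_distrib]
    ring
  have hres : ∀ n, |v n - W n| ≤ (C₀ + C₁ + d * C₂ + D) * ε := by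
    refine abs_le_of_lattice_equation (fun n => hb (n +ᵥ y)) hε
      (v := fun n => v n - W n)
      (r := fun n => ε ^ 2 * (f (latticePoint ε n) - W n)
        + (walkMean (b (n +ᵥ y)) (fun i => W (n + latticeVec i))
          (fun i => W (n - latticeVec i)) - W n)) ?_ ?_ ?_
    · obtain ⟨K, hK⟩ := hv
      refine ⟨K + (K₀ + D * ε), fun n => ?_⟩
      rw [hWn]
      exact (abs_sub _ _).trans (add_le_add (hK n)
        ((abs_add_le _ _).trans (add_le_add (hwK _) (hcorr n))))
    · intro n
      have e := walkMean_add (b (n +ᵥ y)) (fun i => W (n + latticeVec i))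
        (fun i => W (n - latticeVec i)) (fun i => v (n + latticeVec i) - W (n + latticeVec i))
        (fun i => v (n - latticeVec i) - W (n - latticeVec i))
      simp only [add_sub_cancel] at e
      have := heq n
      rw [e] at this
      linarith
    · intro n
      set x := latticePoint ε n
      set z := n +ᵥ y
      -- The coefficient q is split as 1/(2d) plus the excess: the first part is the Laplacian of
      -- the simple walk, the second is what the ψ_j supply.
      have pde : w x - f x = ∑ j, 1 / (2 * (d : ℝ)) * schwartzPartial (schwartzPartial w j) j x
          + (q - 1 / (2 * (d : ℝ))) * schwartzPartial w₀ 0 x := by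
        have h1 := hw.equation x
        rw [← Finset.add_sum_erase _ _ (Finset.mem_univ (0 : Fin d))]
        simp only [coe_schwartzPartial, hw₀]
        linarith
      have hsum : ∑ j, envGenerator d b (ψ j) z * schwartzPartial w₀ j x
          = (q - 1 / (2 * (d : ℝ))) * schwartzPartial w₀ 0 x
            - ∑ j, corrFlux b χ j z * schwartzPartial w₀ j x := by
        simp only [hψ, sub_mul, Finset.sum_sub_distrib, ite_mul, zero_mul, Finset.sum_ite_eq',
          Finset.mem_univ, if_true]
      have E₂ : |∑ j, (stepIncrement b (ψ j) (schwartzPartial w₀ j) ε z x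
          - envGenerator d b (ψ j) z * schwartzPartial w₀ j x)| ≤ d * (C₂ * ε) := by
        refine (Finset.abs_sum_le_sum_abs _ _).trans ?_
        exact (Finset.sum_le_card_nsmul _ _ (C₂ * ε) fun j _ => h₂ j ε hε z x).trans_eq (by simp)
      rw [Finset.sum_sub_distrib, hsum] at E₂
      have E₀ := h₀ ε hε z x
      have E₁ := h₁ ε hε z x
      rw [hχ] at E₁
      rw [hmean, hWn]
      have E₃ := hcorr n
      rw [abs_le] at E₀ E₁ E₂ E₃ ⊢
      have hε2 : 0 ≤ ε ^ 2 := by positivity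
      have F₁ := mul_le_mul_of_nonneg_left E₁.1 hε.le
      have F₁' := mul_le_mul_of_nonneg_left E₁.2 hε.le
      have F₂ := mul_le_mul_of_nonneg_left E₂.1 hε2
      have F₂' := mul_le_mul_of_nonneg_left E₂.2 hε2
      have F₃ := mul_le_mul_of_nonneg_left E₃.1 hε2
      have F₃' := mul_le_mul_of_nonneg_left E₃.2 hε2
      have hf : f x = w x - (∑ j, 1 / (2 * (d : ℝ)) * schwartzPartial (schwartzPartial w j) j x
          + (q - 1 / (2 * (d : ℝ))) * schwartzPartial w₀ 0 x) := by linarith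
      rw [hf]
      -- Order ε cancels by the equation of χ. At order ε² the ψ_j replace the fluxes by q - 1/(2d),
      -- and `hf` removes the rest except -ε² times the corrector part.
      constructor <;> linarith [E₀.1, E₀.2]
  intro n
  have h1 := hres n
  have h2 := hcorr n
  rw [hWn] at h1
  rw [abs_le] at h1 h2 ⊢
  constructor <;> linarith [h1.1, h1.2, h2.1, h2.2]

end Expansion

/-! ### The finite space of drift profiles with its shift action. -/

section Profiles

variable {d : ℕ} {Ω : Type*} [AddAction (Fin d → ℤ) Ω]

variable (d) in
/-- The drift profile seen from `ω`. -/
def driftProfile (b : Ω → ℝ) (ω : Ω) : (Fin d → ℤ) → ℝ := fun n => b (n +ᵥ ω)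

variable (d) in
/-- The space of all drift profiles. -/
def ProfileSpace (b : Ω → ℝ) : Type := {g : (Fin d → ℤ) → ℝ // ∃ ω, driftProfile d b ω = g}

/-- The drift profile of `ω`, as a point of the profile space. -/
def toProfile (b : Ω → ℝ) (ω : Ω) : ProfileSpace d b := ⟨driftProfile d b ω, ω, rfl⟩

lemma toProfile_surjective (b : Ω → ℝ) : Function.Surjective (toProfile (d := d) b) := by
  rintro ⟨_, ω, rfl⟩
  exact ⟨ω, rfl⟩

instance (b : Ω → ℝ) : AddAction (Fin d → ℤ) (ProfileSpace d b) where
  vadd n g := ⟨fun m => g.1 (m + n), by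
    obtain ⟨_, ω, rfl⟩ := g
    exact ⟨n +ᵥ ω, funext fun m => by simp [driftProfile, vadd_vadd]⟩⟩
  zero_vadd g := Subtype.ext (funext fun m => congrArg g.1 (add_zero m))
  add_vadd n n' g := Subtype.ext (funext fun m => congrArg g.1 (add_assoc m n n').symm)

lemma vadd_profile_apply {b : Ω → ℝ} (n : Fin d → ℤ) (g : ProfileSpace d b) (m : Fin d → ℤ) :
    (n +ᵥ g).1 m = g.1 (m + n) := rfl

lemma vadd_toProfile (b : Ω → ℝ) (n : Fin d → ℤ) (ω : Ω) :
    n +ᵥ toProfile (d := d) b ω = toProfile b (n +ᵥ ω) :=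
  Subtype.ext (funext fun m => by
    rw [vadd_profile_apply]
    simp [toProfile, driftProfile, vadd_vadd])

/-- The drift at the origin. -/
def profileDrift (b : Ω → ℝ) (g : ProfileSpace d b) : ℝ := g.1 0

lemma profileDrift_toProfile (b : Ω → ℝ) (ω : Ω) :
    profileDrift b (toProfile (d := d) b ω) = b ω := by
  simp [profileDrift, toProfile, driftProfile]

instance [Finite Ω] (b : Ω → ℝ) : Finite (ProfileSpace d b) :=
  Finite.of_surjective _ (toProfile_surjective b)

end Profiles

/-! ### From ergodicity to transitivity, and from moments to a reflection of profiles. -/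

section Symmetry

variable {d : ℕ} {Ω : Type*} [AddAction (Fin d → ℤ) Ω] [Finite Ω]
  [MeasurableSpace Ω] [MeasurableSingletonClass Ω] {μ : Measure Ω}

omit [AddAction (Fin d → ℤ) Ω] [Finite Ω] [MeasurableSingletonClass Ω] in
lemma of_ae_of_singleton_ne_zero (hμ : ∀ ω : Ω, μ {ω} ≠ 0) {p : Ω → Prop} (h : ∀ᵐ ω ∂μ, p ω)
    (ω : Ω) : p ω := by
  by_contra hω
  exact hμ ω (measure_mono_null (Set.singleton_subset_iff.2 hω) (ae_iff.1 h))

/-- An ergodic action on a finite space whose points have positive mass is transitive. -/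
lemma exists_vadd_eq_of_ergodic (hμ : ∀ ω : Ω, μ {ω} ≠ 0) [ErgodicVAdd (Fin d → ℤ) Ω μ]
    (ω ω' : Ω) : ∃ n : Fin d → ℤ, n +ᵥ ω = ω' := by
  -- An orbit is invariant, hence null or of full measure; positive point masses turn this into
  -- empty or everything.
  have hconst : EventuallyConst (AddAction.orbit (Fin d → ℤ) ω) (ae μ) :=
    ErgodicVAdd.aeconst_of_forall_preimage_vadd_ae_eq (G := Fin d → ℤ)
      (Set.toFinite _).measurableSet fun g => by
        refine Eq.eventuallyEq (Set.ext fun z => ?_)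
        refine ⟨fun h => ?_, AddAction.mem_orbit_of_mem_orbit g⟩
        simpa [vadd_vadd] using AddAction.mem_orbit_of_mem_orbit (-g) h
  rcases eventuallyConst_set.1 hconst with h | h
  · exact of_ae_of_singleton_ne_zero hμ h ω'
  · exact absurd (AddAction.mem_orbit_self ω) (of_ae_of_singleton_ne_zero hμ h ω)

variable [NeZero d] [IsProbabilityMeasure μ] {b : Ω → ℝ}

-- The sign is absorbed into the factors, and the empty product is included, as the induction on
-- lists requires.
omit [Finite Ω] [MeasurableSingletonClass Ω] in
lemma integral_list_prod_eq (hR : ReflectionInvariant (d := d) μ b) (m : List (Fin d → ℤ)) :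
    ∫ ω, (m.map fun x => b (x +ᵥ ω)).prod ∂μ
      = ∫ ω, (m.map fun x => -b (reflect x +ᵥ ω)).prod ∂μ := by
  rcases m.eq_nil_or_concat with rfl | hm
  · simp
  · have hpos : 1 ≤ m.length := by
      obtain ⟨l, a, rfl⟩ := hm
      simp
    have h := hR m.length hpos m.get
    rw [← integral_const_mul] at h
    have e : ∀ g : (Fin d → ℤ) → ℝ, (m.map g).prod = ∏ i, g (m.get i) := fun g => by
      simp
    simp only [e]
    rw [h]
    refine integral_congr_ae (Eventually.of_forall fun ω => ?_)
    simp [Finset.prod_neg]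

/-- Equality of the joint polynomial moments of the drift and of its reflection. -/
lemma integral_list_prod_sub_eq (hR : ReflectionInvariant (d := d) μ b)
    (l : List ((Fin d → ℤ) × ℝ)) (m : List (Fin d → ℤ)) :
    ∫ ω, (l.map fun p => b (p.1 +ᵥ ω) - p.2).prod * (m.map fun x => b (x +ᵥ ω)).prod ∂μ
      = ∫ ω, (l.map fun p => -b (reflect p.1 +ᵥ ω) - p.2).prod
        * (m.map fun x => -b (reflect x +ᵥ ω)).prod ∂μ := by
  induction l generalizing m with
  | nil => simpa using integral_list_prod_eq hR m
  | cons p l ih =>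
    -- Expanding one factor t - c moves t into the second list, which is why `m` is generalized.
    have e : ∀ t P Q : ℝ, (t - p.2) * P * Q = P * (t * Q) - p.2 * (P * Q) := fun t P Q => by ring
    simp only [List.map_cons, List.prod_cons, e]
    rw [integral_sub .of_finite .of_finite, integral_sub .of_finite .of_finite,
      integral_const_mul, integral_const_mul, ih m]
    have := ih (p.1 :: m)
    simp only [List.map_cons, List.prod_cons] at this
    rw [this]

/-- The reflected and negated drift profiles are again drift profiles. -/
lemma exists_reflected_profile (hμ : ∀ ω : Ω, μ {ω} ≠ 0)
    (hR : ReflectionInvariant (d := d) μ b) (ω₀ : Ω) :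
    ∃ ω, ∀ x : Fin d → ℤ, b (x +ᵥ ω) = -b (reflect x +ᵥ ω₀) := by
  by_contra! hne
  choose x hx using hne
  have := Fintype.ofFinite Ω
  -- For each ω the list records a site where the profile of ω differs from the reflected profile of
  -- ω₀. The product over `l` thus vanishes on every profile but not on the reflected one. Doubling
  -- the list squares it, so its zero integral forces it to vanish pointwise.
  let l : List ((Fin d → ℤ) × ℝ) := Finset.univ.toList.map fun ω => (x ω, b (x ω +ᵥ ω))
  have h := integral_list_prod_sub_eq hR (l ++ l) []
  simp only [List.map_append, List.prod_append, List.map_nil, List.prod_nil, mul_one] at h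
  have hzero : ∀ ω, (l.map fun p => b (p.1 +ᵥ ω) - p.2).prod = 0 := fun ω => by
    rw [List.prod_eq_zero_iff]
    simp only [l, List.map_map, List.mem_map, Finset.mem_toList, Finset.mem_univ, true_and]
    exact ⟨ω, by simp⟩
  simp only [hzero, mul_zero, integral_zero] at h
  have h2 := (integral_eq_zero_iff_of_nonneg (fun ω => mul_self_nonneg _) .of_finite).1 h.symm
  have h3 := of_ae_of_singleton_ne_zero hμ h2 ω₀
  simp only [Pi.zero_apply, mul_self_eq_zero, List.prod_eq_zero_iff, l, List.map_map,
    List.mem_map, Finset.mem_toList, Finset.mem_univ, true_and, Function.comp_apply] at h3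
  obtain ⟨ω, hω⟩ := h3
  exact hx ω (by linarith)

omit [Finite Ω] in
lemma reflect_reflect (n : Fin d → ℤ) : reflect (reflect n) = n := by
  ext k
  rcases eq_or_ne k 0 with rfl | hk
  · simp [reflect]
  · simp [reflect, hk]

lemma reflect_add (n m : Fin d → ℤ) : reflect (n + m) = reflect n + reflect m := by
  ext k
  rcases eq_or_ne k 0 with rfl | hk
  · simp [reflect, add_comm]
  · simp [reflect, hk]

/-- The reflection of the profile space. -/
lemma exists_profile_reflection (hμ : ∀ ω : Ω, μ {ω} ≠ 0)
    (hR : ReflectionInvariant (d := d) μ b) :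
    ∃ S : ProfileSpace d b → ProfileSpace d b, (∀ g, profileDrift b (S g) = -profileDrift b g) ∧
      ∀ (n : Fin d → ℤ) g, S (n +ᵥ g) = reflect n +ᵥ S g := by
  refine ⟨fun g => ⟨fun m => -g.1 (reflect m), ?_⟩, fun g => ?_, fun n g => ?_⟩
  · obtain ⟨_, ω₀, rfl⟩ := g
    obtain ⟨ω, hω⟩ := exists_reflected_profile hμ hR ω₀
    exact ⟨ω, funext hω⟩
  · have : reflect (0 : Fin d → ℤ) = 0 := by simp [reflect]
    simp [profileDrift, this]
  · refine Subtype.ext (funext fun m => ?_)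
    change -g.1 (reflect m + n) = -g.1 (reflect (m + reflect n))
    rw [reflect_add, reflect_reflect]

end Symmetry

/-! ### Well-posedness of the discrete problem, discretization bounds, conclusion. -/

section Main

variable {d : ℕ} [NeZero d]

lemma isDiscreteSolution_iff {Ω : Type*} [AddAction (Fin d → ℤ) Ω] {b : Ω → ℝ}
    {f : EuclideanSpace ℝ (Fin d) → ℝ} {ε : ℝ} {v : (Fin d → ℤ) → Ω → ℝ} :
    IsDiscreteSolution b f ε v ↔ (∃ C : ℝ, ∀ n ω, |v n ω| ≤ C) ∧
      ∀ ω n, v n ω - walkMean (b (n +ᵥ ω)) (fun i => v (n + latticeVec i) ω)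
        (fun i => v (n - latticeVec i) ω) + ε ^ 2 * v n ω = ε ^ 2 * f (latticePoint ε n) := by
  simp only [walkMean, ← sub_sub]
  exact ⟨fun h => ⟨h.bounded, fun ω n => h.equation n ω⟩, fun h => ⟨h.1, fun n ω => h.2 ω n⟩⟩

/-- The equation does not couple different ω, so it is solved for each ω separately, with a bound
independent of ω. -/
theorem existsUnique_isDiscreteSolution {Ω : Type*} [AddAction (Fin d → ℤ) Ω] {b : Ω → ℝ}
    (hb : ∀ ω : Ω, |b ω| < 1 / (2 * (d : ℝ))) {f : EuclideanSpace ℝ (Fin d) → ℝ} {M : ℝ}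
    (hf : ∀ x, |f x| ≤ M) {ε : ℝ} (hε : 0 < ε) :
    ∃! v : (Fin d → ℤ) → Ω → ℝ, IsDiscreteSolution b f ε v := by
  simp only [isDiscreteSolution_iff]
  choose v hv using fun ω => exists_lattice_solution (fun n => hb (n +ᵥ ω)) hε
    (g := fun n => f (latticePoint ε n)) fun n => hf _
  refine ⟨fun n ω => v ω n, ⟨⟨M, fun n ω => (hv ω).1 n⟩, fun ω => (hv ω).2⟩, ?_⟩
  rintro v' ⟨⟨C, hC⟩, h'⟩
  ext n ω
  have h0 := abs_le_of_lattice_equation (fun n => hb (n +ᵥ ω)) hε (v := fun n => v' n ω - v ω n)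
    (r := fun _ => 0) (M := 0)
    ⟨C + M, fun n => (abs_sub _ _).trans (add_le_add (hC n ω) ((hv ω).1 n))⟩
    (fun n => by
      have e := walkMean_add (b (n +ᵥ ω)) (fun i => v ω (n + latticeVec i))
        (fun i => v ω (n - latticeVec i))
        (fun i => v' (n + latticeVec i) ω - v ω (n + latticeVec i))
        (fun i => v' (n - latticeVec i) ω - v ω (n - latticeVec i))
      simp only [add_sub_cancel] at e
      have h1 := h' ω n
      have h2 := (hv ω).2 n
      rw [e] at h1
      linarith) (by simp) n
  exact sub_eq_zero.1 (abs_nonpos_iff.1 h0)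

omit [NeZero d] in
lemma norm_latticePoint_floor_sub_le {ε : ℝ} (hε : 0 < ε) (x : EuclideanSpace ℝ (Fin d)) :
    ‖latticePoint ε (latticeFloor ε x) - x‖ ≤ d * ε := by
  refine abs_le_of_sq_le_sq' ?_ (by positivity) |>.2
  rw [EuclideanSpace.norm_sq_eq]
  have h : ∀ i ∈ (Finset.univ : Finset (Fin d)),
      ‖(latticePoint ε (latticeFloor ε x) - x) i‖ ^ 2 ≤ ε ^ 2 := by
    intro i _
    rw [Real.norm_eq_abs, sq_abs]
    have e : (latticePoint ε (latticeFloor ε x) - x) i = -(ε * Int.fract (x i / ε)) := by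
      simp only [latticePoint, latticeFloor, PiLp.sub_apply, Int.fract]
      field_simp
      ring
    rw [e, neg_sq, mul_pow]
    have h1 := Int.fract_nonneg (x i / ε)
    have h2 := Int.fract_lt_one (x i / ε)
    have h3 : Int.fract (x i / ε) ^ 2 ≤ 1 := by nlinarith
    nlinarith [sq_nonneg ε]
  refine (Finset.sum_le_card_nsmul _ _ _ h).trans ?_
  rcases Nat.eq_zero_or_pos d with rfl | hd
  · simp
  · have : (1 : ℝ) ≤ d := by exact_mod_cast hd
    simp only [Finset.card_univ, Fintype.card_fin, nsmul_eq_mul, mul_pow]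
    nlinarith [sq_nonneg ε, mul_nonneg (sub_nonneg.2 this) (sq_nonneg ε)]

open scoped SchwartzMap in
omit [NeZero d] in
lemma schwartz_exists_lipschitz (w : 𝓢(EuclideanSpace ℝ (Fin d), ℝ)) :
    ∃ K, 0 ≤ K ∧ ∀ x y, |w x - w y| ≤ K * ‖x - y‖ := by
  obtain ⟨K, hK, h⟩ := w.decay 0 1
  refine ⟨K, hK.le, fun x y => ?_⟩
  exact Convex.norm_image_sub_le_of_norm_fderiv_le (𝕜 := ℝ) (s := Set.univ)
    (fun z _ => w.differentiableAt) (fun z _ => by simpa [norm_iteratedFDeriv_one] using h z)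
    convex_univ (Set.mem_univ y) (Set.mem_univ x)

end Main

end DriftHomogenization

theorem theorem1p1 {d : ℕ} [NeZero d] {Ω : Type*} [Finite Ω] [MeasurableSpace Ω]
    [MeasurableSingletonClass Ω] (μ : Measure Ω) [IsProbabilityMeasure μ]
    (hμ : ∀ ω : Ω, μ {ω} ≠ 0)
    [AddAction (Fin d → ℤ) Ω] [ErgodicVAdd (Fin d → ℤ) Ω μ]
    (b : Ω → ℝ) (hb : ∀ ω : Ω, |b ω| < 1 / (2 * (d : ℝ)))
    (hR : DriftHomogenization.ReflectionInvariant (d := d) μ b) :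
    ∃ q : ℝ, 0 < q ∧
      ∀ f : EuclideanSpace ℝ (Fin d) → ℝ, ContDiff ℝ ((⊤ : ℕ∞) : WithTop ℕ∞) f → HasCompactSupport f →
        (∀ ε : ℝ, 0 < ε → ∃! v : (Fin d → ℤ) → Ω → ℝ,
          DriftHomogenization.IsDiscreteSolution b f ε v) ∧
        (∃! u : EuclideanSpace ℝ (Fin d) → ℝ,
          DriftHomogenization.IsHomogenizedSolution q f u) ∧
        ∀ (v : ℝ → (Fin d → ℤ) → Ω → ℝ) (u : EuclideanSpace ℝ (Fin d) → ℝ),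
          (∀ ε : ℝ, 0 < ε → DriftHomogenization.IsDiscreteSolution b f ε (v ε)) →
          DriftHomogenization.IsHomogenizedSolution q f u →
          Tendsto
            (fun ε : ℝ => ⨆ (x : EuclideanSpace ℝ (Fin d)) (ω : Ω),
              ‖v ε (DriftHomogenization.latticeFloor ε x) ω - u x‖ₑ)
            (𝓝[>] 0) (𝓝 0) := by
  open DriftHomogenization in
  have hne : Nonempty Ω := nonempty_of_isProbabilityMeasure μ
  have hneY : Nonempty (ProfileSpace d b) := hne.map (toProfile b)
  have hbY : ∀ g : ProfileSpace d b, |profileDrift b g| < 1 / (2 * (d : ℝ)) := fun g => by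
    obtain ⟨ω, rfl⟩ := toProfile_surjective b g
    rw [profileDrift_toProfile]
    exact hb ω
  have htrans : ∀ g g' : ProfileSpace d b, ∃ n : Fin d → ℤ, n +ᵥ g = g' := fun g g' => by
    obtain ⟨ω, rfl⟩ := toProfile_surjective b g
    obtain ⟨ω', rfl⟩ := toProfile_surjective b g'
    obtain ⟨n, rfl⟩ := exists_vadd_eq_of_ergodic (d := d) hμ ω ω'
    exact ⟨n, vadd_toProfile b n ω⟩
  obtain ⟨S, hSb, hS⟩ := exists_profile_reflection hμ hR
  obtain ⟨q, χ, ψ, hq, hχ, hψ⟩ := exists_correctors hbY htrans hSb hS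
  refine ⟨q, hq, fun f hf hc => ?_⟩
  obtain ⟨M, hM⟩ := hc.exists_bound_of_continuous hf.continuous
  obtain ⟨w, hw⟩ := exists_schwartz_isHomogenizedSolution hq.le hf hc
  have huniq : ∀ u, IsHomogenizedSolution q f u → u = w := fun u hu =>
    funext fun x => le_antisymm (hu.le hq.le hw x) (hw.le hq.le hu x)
  refine ⟨fun ε hε => existsUnique_isDiscreteSolution hb hM hε, ⟨w, hw, huniq⟩, ?_⟩
  intro v u hv hu
  rw [huniq u hu]
  obtain ⟨C, hC, hrate⟩ := exists_homogenization_rate hbY w hχ hψ hw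
  obtain ⟨K, hK, hlip⟩ := schwartz_exists_lipschitz w
  have hbound : ∀ ε : ℝ, 0 < ε → ε ≤ 1 → ∀ x ω,
      |v ε (latticeFloor ε x) ω - w x| ≤ (C + K * d) * ε := by
    intro ε hε hε1 x ω
    obtain ⟨⟨B, hB⟩, heq⟩ := isDiscreteSolution_iff.1 (hv ε hε)
    -- For fixed ω the coefficients depend on ω only through its profile, so the rate on the profile
    -- space applies.
    have h1 := hrate ε hε hε1 (toProfile b ω) (fun n => v ε n ω) ⟨B, fun n => hB n ω⟩
      (fun n => by
        rw [vadd_toProfile, profileDrift_toProfile]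
        exact heq ω n) (latticeFloor ε x)
    have h2 := (hlip (latticePoint ε (latticeFloor ε x)) x).trans
      (mul_le_mul_of_nonneg_left (norm_latticePoint_floor_sub_le hε x) hK)
    calc |v ε (latticeFloor ε x) ω - w x| ≤ C * ε + K * (d * ε) :=
          (abs_sub_le _ _ _).trans (add_le_add h1 h2)
      _ = (C + K * d) * ε := by ring
  have hlim : Tendsto (fun ε : ℝ => ENNReal.ofReal ((C + K * d) * ε)) (𝓝[>] 0) (𝓝 0) := by
    have hcont : Continuous fun ε : ℝ => ENNReal.ofReal ((C + K * d) * ε) :=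
      ENNReal.continuous_ofReal.comp (continuous_const.mul continuous_id)
    simpa using (hcont.tendsto 0).mono_left nhdsWithin_le_nhds
  refine tendsto_of_tendsto_of_tendsto_of_le_of_le' tendsto_const_nhds hlim
    (Eventually.of_forall fun _ => zero_le) ?_
  -- The rate holds for 0 < ε ≤ 1 only, which is a neighbourhood of 0 from the right.
  filter_upwards [Ioc_mem_nhdsGT (zero_lt_one' ℝ)] with ε hε
  refine iSup_le fun x => iSup_le fun ω => ?_
  rw [← ofReal_norm, Real.norm_eq_abs]
  exact ENNReal.ofReal_le_ofReal (hbound ε hε.1 hε.2 x ω)
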